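/- **Types and domains.** Pure types are the closed expressions of the grammar $\tau ::= 1 \mid \tau\times\tau \mid \tau\to\tau \mid \tau+\tau \mid \alpha \mid \mathrm{rec}\,\alpha.\tau$. They are interpreted as Scott domains: $[\![1]\!]=\{\bot<\top\}$; products are Cartesian products; $[\![\sigma\to\tau]\!]$ is the set of Scott-continuous functions with the pointwise order; $[\![\sigma+\tau]\!]=([\![\sigma]\!]\amalg[\![\tau]\!])_\bot$ is the disjoint union with a new least element; $[\![\mathrm{rec}\,\alpha.\tau]\!]$ is the canonical (bilimit) solution of its domain equation, with isomorphism $\mathrm{unfold}:[\![\mathrm{rec}\,\alpha.\tau]\!]\cong[\![\tau[\mathrm{rec}\,\alpha.\tau/\alpha]]\!]$. **Formulae.** Iteration terms are $t ::= k\mid 0\mid t+1$ with $k$ an iteration variable. For a context $\mathcal E$ of typed fixpoint variables, formulae of type $\tau$ over $\mathcal E$ are built from $\top$, $\bot$, $\varphi\wedge\psi$, $\varphi\vee\psi$; $\langle\langle\rangle\rangle$ (at type $1$); $\langle\pi_i\rangle\varphi$ at $\tau_1\times\tau_2$ and $\langle\mathrm{in}_i\rangle\varphi$ at $\tau_1+\tau_2$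 for $\varphi$ of type $\tau_i$; $\langle\mathrm{fold}\rangle\varphi$ at $\mathrm{rec}\,\alpha.\tau$ for $\varphi$ of type $\tau[\mathrm{rec}\,\alpha.\tau/\alpha]$; the variables $X:\tau$ of $\mathcal E$; the bounded iterations $(\mu^tX)\varphi$, $(\nu^tX)\varphi$ for $\varphi$ of type $\tau$ over $\mathcal E,X:\tau$; $(\exists k)\varphi$, $(\forall k)\varphi$; and $\psi\Vdash\varphi$ of type $\sigma\to\tau$ for $\psi$, $\varphi$ of types $\sigma$, $\tau$ over the empty context. The languages $L^{s}(\mathcal E;\tau)$, for the polarities $s\in\{\pm,+,-\}$, are closed under all these formers, with the following restrictions: $(\exists k)\varphi\in L^{s}$ only if $s=+$, $\varphi\in L^+$ and $k\,\mathrm{Pos}\,\varphi$; $(\forall k)\varphi\in L^{s}$ only if $s=-$, $\varphi\in L^-$ and $k\,\mathrm{Neg}\,\varphi$; $(\psi\Vdash\varphi)\in L^s$ iff $\psi\in L^{-s}$ and $\varphi\in L^s$ (where $-\pm=\pm$). Here $\mathrm{Pos}$ and $\mathrm{Neg}$ are the least predicates such that: $k\,\mathrm{Pos}\,\varphi$ and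 $k\,\mathrm{Neg}\,\varphi$ hold if $k\notin FV(\varphi)$; both are preserved by $\wedge$, $\vee$ and the modalities; $\mathrm{Pos}$ is preserved by $(\exists l)$ and $(\mu^tX)$, and by $(\nu^tX)$ if $k\notin FV(t)$; $\mathrm{Neg}$ is preserved by $(\forall l)$ and $(\nu^tX)$, and by $(\mu^tX)$ if $k\notin FV(t)$; $k\,\mathrm{Pos}\,(\psi\Vdash\varphi)$ if $k\,\mathrm{Neg}\,\psi$ and $k\,\mathrm{Pos}\,\varphi$; and dually for $\mathrm{Neg}$. The set $L^\wedge(\tau)$ of *conjunctive* formulae consists of the formulae over the empty context built from $\top,\bot,\wedge$, $\langle\langle\rangle\rangle$, the modalities and $\Vdash$ only. **Semantics.** A formula of type $\tau$ denotes a subset of $[\![\tau]\!]$ under a valuation: $\top,\bot,\wedge,\vee$ are $[\![\tau]\!],\emptyset,\cap,\cup$; $[\![\langle\langle\rangle\rangle]\!]=\{\top\}$; $[\![\langle\pi_i\rangle\varphi]\!]=\{x\mid\pi_i(x)\in[\![\varphi]\!]\}$; $[\![\langle\mathrm{in}_i\rangle\varphi]\!]=\{\mathrm{in}_i(x)\mid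 x\in[\![\varphi]\!]\}$; $[\![\langle\mathrm{fold}\rangle\varphi]\!]=\{x\mid\mathrm{unfold}(x)\in[\![\varphi]\!]\}$; $[\![\psi\Vdash\varphi]\!]=\{f\mid\forall x\in[\![\psi]\!],\ f(x)\in[\![\varphi]\!]\}$; $(\mu^tX)\varphi$ and $(\nu^tX)\varphi$ are the $t$-fold iterates of $S\mapsto[\![\varphi]\!][S/X]$ on $\emptyset$ and on the whole domain; $(\exists k),(\forall k)$ are $\bigcup_{n\in\mathbb N}$ and $\bigcap_{n\in\mathbb N}$. **Deduction.** A sequent is a pair $\psi\vdash\varphi$ with $\psi,\varphi\in L^s(\mathcal E;\tau)$ for some polarity $s$. Derivable sequents and the predicate $C$ on conjunctive formulae are defined by simultaneous induction. In the rules below, which are read as restricted to sequents, "$A\Rightarrow B$" means "from $A$ infer $B$", and $\Delta$ ranges over $\pi_1,\pi_2,\mathrm{in}_1,\mathrm{in}_2,\mathrm{fold}$. * Propositional: $\varphi\vdash\varphi$; $\psi\vdash\theta,\ \theta\vdash\varphi\Rightarrow\psi\vdash\varphi$; $\psi\wedge(\varphi\vee\theta)\vdash(\psi\wedge\varphi)\vee(\psi\wedge\theta)$;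 $\psi\vdash\varphi_1,\ \psi\vdash\varphi_2\Rightarrow\psi\vdash\varphi_1\wedge\varphi_2$; $\psi_i\vdash\varphi\Rightarrow\psi_1\wedge\psi_2\vdash\varphi$ ($i=1,2$); $\psi\vdash\top$; $\psi\vdash\varphi_i\Rightarrow\psi\vdash\varphi_1\vee\varphi_2$ ($i=1,2$); $\psi_1\vdash\varphi,\ \psi_2\vdash\varphi\Rightarrow\psi_1\vee\psi_2\vdash\varphi$; $\bot\vdash\varphi$. * Modal: $\langle\mathrm{in}_1\rangle\varphi\wedge\langle\mathrm{in}_2\rangle\psi\vdash\bot$; $\psi\vdash\varphi\Rightarrow\langle\Delta\rangle\psi\vdash\langle\Delta\rangle\varphi$; $\psi'\vdash\psi,\ \varphi\vdash\varphi'\Rightarrow(\psi\Vdash\varphi)\vdash(\psi'\Vdash\varphi')$; $\langle\Delta\rangle\varphi_1\wedge\langle\Delta\rangle\varphi_2\vdash\langle\Delta\rangle(\varphi_1\wedge\varphi_2)$; $\top\vdash\langle\Delta\rangle\top$ for $\Delta\ne\mathrm{in}_i$; $(\forall k)\langle\Delta\rangle\varphi\vdash\langle\Delta\rangle(\forall k)\varphi$;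 $\langle\Delta\rangle(\varphi_1\vee\varphi_2)\vdash\langle\Delta\rangle\varphi_1\vee\langle\Delta\rangle\varphi_2$; $\langle\Delta\rangle\bot\vdash\bot$; $\langle\Delta\rangle(\exists k)\varphi\vdash(\exists k)\langle\Delta\rangle\varphi$. * Quantifiers: $\psi\vdash\varphi[t/k]\Rightarrow\psi\vdash(\exists k)\varphi$; $\theta\wedge\varphi\vdash\psi\Rightarrow\theta\wedge(\exists k)\varphi\vdash\psi$ if $k\notin FV(\psi,\theta)$; $(\exists k)(\exists l)\varphi\vdash(\exists k)\varphi[k/l]$; $\varphi[t/k]\vdash\psi\Rightarrow(\forall k)\varphi\vdash\psi$; $\psi\vdash\varphi\vee\theta\Rightarrow\psi\vdash(\forall k)\varphi\vee\theta$ if $k\notin FV(\psi,\theta)$; $(\forall k)\varphi[k/l]\vdash(\forall k)(\forall l)\varphi$; and, for $\eta\in\{\mu,\nu\}$ and $k\notin FV(t)$: $(\eta^tX)(\exists k)\varphi\vdash(\exists k)(\eta^tX)\varphi$ and $(\forall k)(\eta^tX)\varphi\vdash(\eta^tX)(\forall k)\varphi$. * Bounded iteration: $(\mu^0X)\varphi\vdash\bot$;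 $(\mu^tX)\varphi\vdash\psi\Rightarrow(\mu^{t+1}X)\varphi\vdash\varphi[\psi/X]$; $\varphi[(\mu^tX)\varphi/X]\vdash(\mu^{t+1}X)\varphi$; $\top\vdash(\nu^0X)\varphi$; $\psi\vdash(\nu^tX)\varphi\Rightarrow\varphi[\psi/X]\vdash(\nu^{t+1}X)\varphi$; $(\nu^{t+1}X)\varphi\vdash\varphi[(\nu^tX)\varphi/X]$; $\psi\vdash\varphi\Rightarrow(\eta^tX)\psi\vdash(\eta^tX)\varphi$ for $\eta\in\{\mu,\nu\}$. * Implication: $((\forall k)\psi\Vdash\varphi)\vdash(\exists k)(\psi\Vdash\varphi)$ if $k\notin FV(\varphi)$; $(\psi\Vdash(\exists k)\varphi)\vdash(\exists k)(\psi\Vdash\varphi)$ if $\psi\in L^\pm$ and $k\notin FV(\psi)$; $(\forall k)(\psi\Vdash\varphi)\vdash((\exists k)\psi\Vdash\varphi)$ if $k\notin FV(\varphi)$; $(\forall k)(\psi\Vdash\varphi)\vdash(\psi\Vdash(\forall k)\varphi)$ if $k\notin FV(\psi)$; $(\psi\Vdash\varphi_1)\wedge(\psi\Vdash\varphi_2)\vdash(\psi\Vdash\varphi_1\wedge\varphi_2)$;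 $\top\vdash(\psi\Vdash\top)$; $(\psi_1\Vdash\varphi)\wedge(\psi_2\Vdash\varphi)\vdash(\psi_1\vee\psi_2\Vdash\varphi)$; $\top\vdash(\bot\Vdash\varphi)$; and, for conjunctive $\delta$: $(\delta\Vdash\varphi_1\vee\varphi_2)\vdash(\delta\Vdash\varphi_1)\vee(\delta\Vdash\varphi_2)$, and $C(\delta)\Rightarrow(\delta\Vdash\bot)\vdash\bot$. * Consistency: $C(\top)$; $C(\langle\langle\rangle\rangle)$; $C(\varphi)\Rightarrow C(\langle\mathrm{fold}\rangle\varphi)$ and $C(\varphi)\Rightarrow C(\langle\mathrm{in}_i\rangle\varphi)$; $C(\varphi),\ C(\psi)\Rightarrow C(\langle\pi_1\rangle\varphi\wedge\langle\pi_2\rangle\psi)$; $C(\psi),\ \psi\vdash\varphi\Rightarrow C(\varphi)$ for $\varphi$ conjunctive; and, for a finite family $(\psi_i,\varphi_i)_{i\in I}$: if $C(\psi_i)$ and $C(\varphi_i)$ for all $i\in I$, and for every $J\subseteq I$ either $\bigwedge_{j\in J}\psi_j\vdash\bot$ is derivable or $C(\bigwedge_{j\in J}\varphi_j)$, then $C(\bigwedge_{i\in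 I}(\psi_i\Vdash\varphi_i))$ (the empty conjunction being $\top$). **Theorem (Completeness of $L^\wedge$).** Let $\tau$ be a pure type and let $\varphi,\psi\in L^\wedge(\tau)$. 1. If $[\![\varphi]\!]\neq\emptyset$, then $C(\varphi)$ is derivable. 2. If $[\![\psi]\!]\subseteq[\![\varphi]\!]$, then $\psi\vdash\varphi$ is derivable. -/

import Mathlib

noncomputable section
namespace PosLog

/-- Pure type expressions with (at most) `m` free type variables, as de Bruijn indices;
`recty τ` is the recursive type `rec α. τ`. -/
inductive TyExpr : ℕ → Type
  | var {m : ℕ} : Fin m → TyExpr m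
  | unit {m : ℕ} : TyExpr m
  | prod {m : ℕ} : TyExpr m → TyExpr m → TyExpr m
  | arr {m : ℕ} : TyExpr m → TyExpr m → TyExpr m
  | sum {m : ℕ} : TyExpr m → TyExpr m → TyExpr m
  | recty {m : ℕ} : TyExpr (m + 1) → TyExpr m

namespace TyExpr

/-- Renaming of type variables. -/
def rename : {m k : ℕ} → (Fin m → Fin k) → TyExpr m → TyExpr k
  | _, _, r, var i => var (r i)
  | _, _, _, unit => unit
  | _, _, r, prod σ τ => prod (rename r σ) (rename r τ)
  | _, _, r, arr σ τ => arr (rename r σ) (rename r τ)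
  | _, _, r, sum σ τ => sum (rename r σ) (rename r τ)
  | _, _, r, recty τ => recty (rename (Fin.cases 0 fun i => (r i).succ) τ)

/-- Capture-avoiding simultaneous substitution. -/
def subst : {m k : ℕ} → (Fin m → TyExpr k) → TyExpr m → TyExpr k
  | _, _, s, var i => s i
  | _, _, _, unit => unit
  | _, _, s, prod σ τ => prod (subst s σ) (subst s τ)
  | _, _, s, arr σ τ => arr (subst s σ) (subst s τ)
  | _, _, s, sum σ τ => sum (subst s σ) (subst s τ)
  | _, _, s, recty τ => recty (subst (Fin.cases (var 0) fun i => (s i).rename Fin.succ) τ)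

/-- The unfolding `τ[rec α. τ / α]`. -/
def unfolding {m : ℕ} (τ : TyExpr (m + 1)) : TyExpr m :=
  τ.subst (Fin.cases (recty τ) var)

end TyExpr

/-- Pure types: the closed type expressions. -/
abbrev Ty : Type := TyExpr 0

/-- Finite partial orders with a least element. -/
structure FinPo where
  carrier : Type
  [po : PartialOrder carrier]
  [bot : OrderBot carrier]
  [fin : Finite carrier]

instance : CoeSort FinPo Type := ⟨FinPo.carrier⟩
instance (P : FinPo) : PartialOrder P := P.po
instance (P : FinPo) : OrderBot P := P.bot
instance (P : FinPo) : Finite P := P.fin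

instance finiteOrderHom (P Q : FinPo) : Finite (P →o Q) := DFunLike.finite _
instance finiteWithBotSum (P Q : FinPo) : Finite (WithBot (P ⊕ Q)) :=
  inferInstanceAs (Finite (Option (P ⊕ Q)))

/-- The `n`-th finite approximation of a pure type: its semantics cut off at constructor depth `n`,
starting from the one-point domain at depth `0`.  All approximations are finite, so that the
monotone maps between them are exactly the Scott-continuous ones.  (Free type variables, which do
not occur in pure types, are interpreted by the one-point domain.) -/
def approx {m : ℕ} : ℕ → TyExpr m → FinPo
  | 0, _ => ⟨PUnit⟩
  | _ + 1, .var _ => ⟨PUnit⟩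
  | _ + 1, .unit => ⟨Bool⟩
  | n + 1, .prod σ τ => ⟨approx n σ × approx n τ⟩
  | n + 1, .arr σ τ => ⟨approx n σ →o approx n τ⟩
  | n + 1, .sum σ τ => ⟨WithBot (approx n σ ⊕ approx n τ)⟩
  | n + 1, .recty τ => approx n τ.unfolding

/-- The action of the lifted sum `(A ⨿ B)_⊥` on monotone maps. -/
def liftSum {A B A' B' : Type} [PartialOrder A] [PartialOrder B] [PartialOrder A']
    [PartialOrder B'] (f : A →o A') (g : B →o B') : WithBot (A ⊕ B) →o WithBot (A' ⊕ B') where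
  toFun := WithBot.map (Sum.map f g)
  monotone' := Monotone.withBot_map fun a b h => by
    cases h with
    | inl h => exact Sum.LiftRel.inl (f.monotone h)
    | inr h => exact Sum.LiftRel.inr (g.monotone h)

/-- The action of the function space on monotone maps, contravariant in the first argument. -/
def arrMap {A B A' B' : Type} [PartialOrder A] [PartialOrder B] [PartialOrder A']
    [PartialOrder B'] (f : A' →o A) (g : B →o B') : (A →o B) →o (A' →o B') where
  toFun h := g.comp (h.comp f)
  monotone' _ _ hh a := g.monotone (hh (f a))

mutual
/-- The canonical map from the `n`-th to the `k`-th approximation: the projection of an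
embedding-projection pair if `k ≤ n`, its embedding if `n ≤ k`. -/
def tr {m : ℕ} : (n k : ℕ) → (τ : TyExpr m) → approx n τ →o approx k τ
  | 0, _, _ => OrderHom.const _ ⊥
  | _ + 1, 0, _ => OrderHom.const _ ⊥
  | _ + 1, _ + 1, .var _ => OrderHom.id
  | _ + 1, _ + 1, .unit => OrderHom.id
  | n + 1, k + 1, .prod σ τ => OrderHom.prodMap (tr n k σ) (tr n k τ)
  | n + 1, k + 1, .arr σ τ => arrMap (rt n k σ) (tr n k τ)
  | n + 1, k + 1, .sum σ τ => liftSum (tr n k σ) (tr n k τ)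
  | n + 1, k + 1, .recty τ => tr n k τ.unfolding
termination_by structural n => n
/-- The canonical map from the `k`-th to the `n`-th approximation (equal to `tr k n`, see
`rt_eq_tr`); a separate function only because `tr` swaps its arguments at function types. -/
def rt {m : ℕ} : (n k : ℕ) → (τ : TyExpr m) → approx k τ →o approx n τ
  | 0, _, _ => OrderHom.const _ ⊥
  | _ + 1, 0, _ => OrderHom.const _ ⊥
  | _ + 1, _ + 1, .var _ => OrderHom.id
  | _ + 1, _ + 1, .unit => OrderHom.id
  | n + 1, k + 1, .prod σ τ => OrderHom.prodMap (rt n k σ) (rt n k τ)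
  | n + 1, k + 1, .arr σ τ => arrMap (tr n k σ) (rt n k τ)
  | n + 1, k + 1, .sum σ τ => liftSum (rt n k σ) (rt n k τ)
  | n + 1, k + 1, .recty τ => rt n k τ.unfolding
termination_by structural n => n
end


theorem rt_eq_tr_aux {m : ℕ} (n : ℕ) :
    ∀ (k : ℕ) (τ : TyExpr m), rt n k τ = tr k n τ ∧ rt k n τ = tr n k τ := by
  induction n with
  | zero => intro k τ; cases k <;> exact ⟨rfl, rfl⟩
  | succ n ih =>
    intro k τ
    cases k with
    | zero => exact ⟨rfl, rfl⟩
    | succ k =>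
      cases τ with
      | var i => exact ⟨rfl, rfl⟩
      | unit => exact ⟨rfl, rfl⟩
      | prod σ τ =>
        simp only [rt, tr, (ih k σ).1, (ih k τ).1, (ih k σ).2, (ih k τ).2]; exact ⟨rfl, rfl⟩
      | arr σ τ =>
        simp only [rt, tr, (ih k σ).1, (ih k τ).1, (ih k σ).2, (ih k τ).2]; exact ⟨rfl, rfl⟩
      | sum σ τ =>
        simp only [rt, tr, (ih k σ).1, (ih k τ).1, (ih k σ).2, (ih k τ).2]; exact ⟨rfl, rfl⟩
      | recty τ => exact ih k τ.unfolding

theorem rt_eq_tr {m : ℕ} (n k : ℕ) (τ : TyExpr m) : rt n k τ = tr k n τ :=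
  (rt_eq_tr_aux n k τ).1

theorem tr_zero_left {m : ℕ} (k : ℕ) (τ : TyExpr m) (a : approx 0 τ) : tr 0 k τ a = ⊥ := rfl

theorem tr_zero_right {m : ℕ} (n : ℕ) (τ : TyExpr m) (a : approx n τ) : tr n 0 τ a = ⊥ := by
  cases n <;> rfl

/-- Application of an approximation at an arrow type. -/
def apx {m n : ℕ} {σ τ : TyExpr m} (h : approx (n + 1) (.arr σ τ)) (a : approx n σ) :
    approx n τ :=
  OrderHom.toFun (α := approx n σ) (β := approx n τ) h a

theorem apx_ext {m n : ℕ} {σ τ : TyExpr m} {f g : approx (n + 1) (.arr σ τ)}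
    (h : ∀ a, apx f a = apx g a) : f = g :=
  OrderHom.ext (α := approx n σ) (β := approx n τ) f g (funext h)

theorem apx_mono {m n : ℕ} {σ τ : TyExpr m} {f g : approx (n + 1) (.arr σ τ)}
    {a b : approx n σ} (h : f ≤ g) (hab : a ≤ b) : apx f a ≤ apx g b :=
  (OrderHom.monotone' (α := approx n σ) (β := approx n τ) f hab).trans (h b)

theorem apx_tr {m : ℕ} (n k : ℕ) (σ τ : TyExpr m) (h : approx (n + 1) (.arr σ τ))
    (a : approx k σ) :
    apx (tr (n + 1) (k + 1) (.arr σ τ) h) a = tr n k τ (apx h (tr k n σ a)) := by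
  change tr n k τ (apx h (rt n k σ a)) = _
  rw [rt_eq_tr]

/-- Left injection at the level of approximations. -/
def inlx {m n : ℕ} {σ : TyExpr m} (τ : TyExpr m) (a : approx n σ) : approx (n + 1) (.sum σ τ) :=
  WithBot.some (α := approx n σ ⊕ approx n τ) (Sum.inl a)

/-- Right injection at the level of approximations. -/
def inrx {m n : ℕ} (σ : TyExpr m) {τ : TyExpr m} (a : approx n τ) : approx (n + 1) (.sum σ τ) :=
  WithBot.some (α := approx n σ ⊕ approx n τ) (Sum.inr a)

theorem sumx_cases {m n : ℕ} {σ τ : TyExpr m} (x : approx (n + 1) (.sum σ τ)) :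
    x = ⊥ ∨ (∃ a, x = inlx τ a) ∨ ∃ b, x = inrx σ b := by
  rcases (show WithBot (approx n σ ⊕ approx n τ) from x) with _ | a | b
  · exact Or.inl rfl
  · exact Or.inr (Or.inl ⟨a, rfl⟩)
  · exact Or.inr (Or.inr ⟨b, rfl⟩)

theorem tr_inlx {m : ℕ} (n k : ℕ) (σ τ : TyExpr m) (a : approx n σ) :
    tr (n + 1) (k + 1) (.sum σ τ) (inlx τ a) = inlx τ (tr n k σ a) := rfl

theorem tr_inrx {m : ℕ} (n k : ℕ) (σ τ : TyExpr m) (a : approx n τ) :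
    tr (n + 1) (k + 1) (.sum σ τ) (inrx σ a) = inrx σ (tr n k τ a) := rfl

theorem inlx_le {m n : ℕ} {σ τ : TyExpr m} {a b : approx n σ} :
    inlx τ a ≤ inlx τ b ↔ a ≤ b :=
  WithBot.coe_le_coe.trans Sum.inl_le_inl_iff

theorem inrx_le {m n : ℕ} {σ τ : TyExpr m} {a b : approx n τ} :
    inrx σ a ≤ inrx σ b ↔ a ≤ b :=
  WithBot.coe_le_coe.trans Sum.inr_le_inr_iff

theorem tr_bot {m : ℕ} (n : ℕ) : ∀ (k : ℕ) (τ : TyExpr m), tr n k τ ⊥ = ⊥ := by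
  induction n with
  | zero => intro k τ; rfl
  | succ n ih =>
    intro k τ
    cases k with
    | zero => rfl
    | succ k =>
      cases τ with
      | var i => rfl
      | unit => rfl
      | prod σ τ => exact Prod.ext (ih k σ) (ih k τ)
      | arr σ τ =>
        refine apx_ext fun a => ?_
        rw [apx_tr]
        exact ih k τ
      | sum σ τ => rfl
      | recty τ => exact ih k τ.unfolding

theorem tr_tr_aux {m : ℕ} (l : ℕ) : ∀ (n k : ℕ) (τ : TyExpr m) (a : approx n τ),
    (n ≤ l ∨ k ≤ l → tr l k τ (tr n l τ a) = tr n k τ a) ∧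
      tr l k τ (tr n l τ a) ≤ tr n k τ a := by
  induction l with
  | zero =>
    intro n k τ a
    rw [tr_zero_right, tr_bot]
    refine ⟨?_, bot_le⟩
    rintro (h | h)
    · obtain rfl := Nat.le_zero.1 h; rfl
    · obtain rfl := Nat.le_zero.1 h; rw [tr_zero_right]
  | succ l ih =>
    intro n k τ a
    cases n with
    | zero => rw [tr_zero_left, tr_zero_left, tr_bot]; exact ⟨fun _ => rfl, le_rfl⟩
    | succ n =>
    cases k with
    | zero => rw [tr_zero_right, tr_zero_right]; exact ⟨fun _ => rfl, le_rfl⟩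
    | succ k =>
    simp only [Nat.succ_le_succ_iff]
    cases τ with
    | var i => exact ⟨fun _ => rfl, le_rfl⟩
    | unit => exact ⟨fun _ => rfl, le_rfl⟩
    | prod σ τ =>
      exact ⟨fun h => Prod.ext ((ih n k σ _).1 h) ((ih n k τ _).1 h),
        (ih n k σ _).2, (ih n k τ _).2⟩
    | arr σ τ =>
      constructor
      · intro h
        refine apx_ext fun b => ?_
        rw [apx_tr, apx_tr, apx_tr, (ih k n σ b).1 h.symm, (ih n k τ _).1 h]
      · intro b
        change apx _ b ≤ apx _ b
        rw [apx_tr, apx_tr, apx_tr]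
        exact ((ih n k τ _).2).trans
          ((tr n k τ).monotone (apx_mono le_rfl (ih k n σ b).2))
    | sum σ τ =>
      rcases sumx_cases a with rfl | ⟨a, rfl⟩ | ⟨a, rfl⟩
      · rw [tr_bot, tr_bot, tr_bot]; exact ⟨fun _ => rfl, le_rfl⟩
      · rw [tr_inlx, tr_inlx, tr_inlx]
        exact ⟨fun h => congrArg _ ((ih n k σ a).1 h), inlx_le.2 (ih n k σ a).2⟩
      · rw [tr_inrx, tr_inrx, tr_inrx]
        exact ⟨fun h => congrArg _ ((ih n k τ a).1 h), inrx_le.2 (ih n k τ a).2⟩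
    | recty τ => exact ih n k τ.unfolding a

theorem tr_tr {m : ℕ} {n l k : ℕ} (h : n ≤ l ∨ k ≤ l) (τ : TyExpr m) (a : approx n τ) :
    tr l k τ (tr n l τ a) = tr n k τ a := (tr_tr_aux l n k τ a).1 h

theorem tr_tr_le {m : ℕ} (n l k : ℕ) (τ : TyExpr m) (a : approx n τ) :
    tr l k τ (tr n l τ a) ≤ tr n k τ a := (tr_tr_aux l n k τ a).2

theorem tr_self {m : ℕ} (n : ℕ) : ∀ (τ : TyExpr m) (a : approx n τ), tr n n τ a = a := by
  induction n with
  | zero => intro τ a; rfl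
  | succ n ih =>
    intro τ a
    cases τ with
    | var i => rfl
    | unit => rfl
    | prod σ τ => exact Prod.ext (ih σ _) (ih τ _)
    | arr σ τ =>
      refine apx_ext fun b => ?_
      rw [apx_tr, ih σ, ih τ]
    | sum σ τ =>
      rcases sumx_cases a with rfl | ⟨a, rfl⟩ | ⟨a, rfl⟩
      · exact tr_bot _ _ _
      · rw [tr_inlx, ih]
      · rw [tr_inrx, ih]
    | recty τ => exact ih τ.unfolding a

/-- The limit of the finite approximations of `τ` along the projections, i.e. the colimit of the
`ω`-chain of their embeddings: compatible threads, ordered pointwise. -/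
structure Lim {m : ℕ} (τ : TyExpr m) : Type where
  val : ∀ n, approx n τ
  property : ∀ n k, k ≤ n → tr n k τ (val n) = val k

theorem Lim.val_injective {m : ℕ} {τ : TyExpr m} :
    Function.Injective (Lim.val : Lim τ → ∀ n, approx n τ) := by
  rintro ⟨x, hx⟩ ⟨y, hy⟩ h
  cases h
  rfl

instance {m : ℕ} (τ : TyExpr m) : PartialOrder (Lim τ) where
  le x y := ∀ n, x.val n ≤ y.val n
  le_refl x n := le_rfl
  le_trans x y z h h' n := (h n).trans (h' n)
  le_antisymm x y h h' := Lim.val_injective (funext fun n => le_antisymm (h n) (h' n))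

/-- Scott-continuous functions, ordered pointwise. -/
structure ScottMap (X Y : Type) [PartialOrder X] [PartialOrder Y] : Type where
  val : X → Y
  property : ScottContinuous val

theorem ScottMap.val_injective {X Y : Type} [PartialOrder X] [PartialOrder Y] :
    Function.Injective (ScottMap.val : ScottMap X Y → X → Y) := by
  rintro ⟨x, hx⟩ ⟨y, hy⟩ h
  cases h
  rfl

instance (X Y : Type) [PartialOrder X] [PartialOrder Y] : PartialOrder (ScottMap X Y) where
  le f g := ∀ x, f.val x ≤ g.val x
  le_refl f x := le_rfl
  le_trans f g h p q x := (p x).trans (q x)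
  le_antisymm f g p q := ScottMap.val_injective (funext fun x => le_antisymm (p x) (q x))

/-- The interpretation of pure types as Scott domains.  `Unit` is `{⊥ < ⊤}` (as `Bool`), products
are Cartesian products, arrow types are the spaces of Scott-continuous functions with the pointwise
order, sums are the weak coproducts `(X ⨿ Y)_⊥`, and recursive types are the canonical solutions of
the domain equations, obtained as bilimits of approximations that start from the one-point domain;
see `unfold` for the isomorphism with the unfolded type. -/
def den {m : ℕ} : TyExpr m → PartOrd.{0}
  | .var _ => PartOrd.of PUnit
  | .unit => PartOrd.of Bool
  | .prod σ τ => PartOrd.of (den σ × den τ)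
  | .arr σ τ => PartOrd.of (ScottMap (den σ) (den τ))
  | .sum σ τ => PartOrd.of (WithBot (den σ ⊕ den τ))
  | .recty τ => PartOrd.of (Lim (.recty τ))


namespace Lim

variable {m : ℕ} {σ τ : TyExpr m}

theorem le_iff {x y : Lim τ} : x ≤ y ↔ ∀ n, x.1 (n + 1) ≤ y.1 (n + 1) := by
  refine ⟨fun h n => h (n + 1), fun h n => ?_⟩
  cases n with
  | zero => exact le_of_eq rfl
  | succ n => exact h n

theorem ext {x y : Lim τ} (h : ∀ n, x.1 (n + 1) = y.1 (n + 1)) : x = y :=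
  le_antisymm (le_iff.2 fun n => (h n).le) (le_iff.2 fun n => (h n).ge)

/-- A thread from its components at positive levels. -/
def succMk (y : ∀ n, approx (n + 1) τ)
    (h : ∀ n k, k ≤ n → tr (n + 1) (k + 1) τ (y n) = y k) : Lim τ :=
  ⟨fun n => Nat.casesOn n ⊥ y, fun n k hk => by
    cases k with
    | zero => rfl
    | succ k =>
      cases n with
      | zero => exact absurd hk (by omega)
      | succ n => exact h n k (by omega)⟩

/-- The canonical embedding of the `n`-th approximation. -/
def emb (τ : TyExpr m) (n : ℕ) (a : approx n τ) : Lim τ :=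
  ⟨fun k => tr n k τ a, fun _ _ h => tr_tr (Or.inr h) τ a⟩

theorem emb_mono (n : ℕ) {a b : approx n τ} (h : a ≤ b) : emb τ n a ≤ emb τ n b :=
  fun k => (tr n k τ).monotone h

theorem emb_le (x : Lim τ) (n : ℕ) : emb τ n (x.1 n) ≤ x := by
  intro k
  rcases le_total k n with h | h
  · exact (x.2 n k h).le
  · change tr n k τ (x.1 n) ≤ x.1 k
    rw [← x.2 k n h]
    exact (tr_tr_le k n k τ _).trans (tr_self k τ _).le

theorem emb_le_emb (x : Lim τ) {n k : ℕ} (h : n ≤ k) :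
    emb τ n (x.1 n) ≤ emb τ k (x.1 k) := by
  intro l
  change tr n l τ (x.1 n) ≤ tr k l τ (x.1 k)
  rw [← x.2 k n h]
  exact tr_tr_le k n l τ _

theorem isLUB_emb (x : Lim τ) : IsLUB (Set.range fun n => emb τ n (x.1 n)) x := by
  refine ⟨?_, fun y hy n => ?_⟩
  · rintro _ ⟨n, rfl⟩
    exact emb_le x n
  · have := hy ⟨n, rfl⟩ n
    change tr n n τ (x.1 n) ≤ y.1 n at this
    rwa [tr_self] at this

theorem directed_emb (x : Lim τ) :
    DirectedOn (· ≤ ·) (Set.range fun n => emb τ n (x.1 n)) := by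
  rintro _ ⟨n, rfl⟩ _ ⟨k, rfl⟩
  exact ⟨_, ⟨max n k, rfl⟩, emb_le_emb x (le_max_left n k), emb_le_emb x (le_max_right n k)⟩

/-- Least upper bounds of directed sets are attained at every finite level. -/
theorem exists_eq_of_isLUB {d : Set (Lim τ)} (hn : d.Nonempty)
    (hd : DirectedOn (· ≤ ·) d) {x : Lim τ} (hx : IsLUB d x) (n : ℕ) :
    ∃ y ∈ d, y.1 n = x.1 n := by
  have hmax : ∀ n, ∃ y ∈ d, ∀ z ∈ d, z.1 n ≤ y.1 n := by
    intro n
    obtain ⟨a, ⟨y, hy, rfl⟩, ha⟩ :=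
      (Set.toFinite ((fun z : Lim τ => z.1 n) '' d)).exists_maximal (hn.image _)
    refine ⟨y, hy, fun z hz => ?_⟩
    obtain ⟨w, hw, hyw, hzw⟩ := hd y hy z hz
    exact (hzw n).trans (ha ⟨w, hw, rfl⟩ (hyw n))
  choose w hw hmw using hmax
  let u : Lim τ := ⟨fun n => (w n).1 n, fun n k hk => le_antisymm
    (((w n).2 n k hk).trans_le (hmw k _ (hw n)))
    (((w k).2 n k hk).symm.trans_le ((tr n k τ).monotone (hmw n _ (hw k))))⟩
  have hu : IsLUB d u := ⟨fun z hz n => hmw n z hz, fun y hy n => hy (hw n) n⟩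
  obtain rfl := hu.unique hx
  exact ⟨w n, hw n, rfl⟩

end Lim

section Iso

variable {m : ℕ}

/-- A free type variable. -/
def limVar (i : Fin m) : Lim (.var i : TyExpr m) ≃o PUnit.{1} where
  toFun _ := ⟨⟩
  invFun _ := Lim.succMk (fun _ => (⟨⟩ : PUnit)) fun _ _ _ => rfl
  left_inv _ := Lim.ext fun _ => rfl
  right_inv _ := rfl
  map_rel_iff' := ⟨fun _ => Lim.le_iff.2 fun _ => le_of_eq rfl, fun _ => le_rfl⟩

/-- The limit at the unit type. -/
def limUnit : Lim (.unit : TyExpr m) ≃o Bool where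
  toFun x := x.1 1
  invFun b := Lim.succMk (fun _ => b) fun _ _ _ => rfl
  left_inv x := Lim.ext fun n => (x.2 (n + 1) 1 (by omega)).symm
  right_inv _ := rfl
  map_rel_iff' {x y} := by
    refine ⟨fun h => Lim.le_iff.2 fun n => ?_, fun h => h 1⟩
    have hx : x.1 (n + 1) = x.1 1 := x.2 (n + 1) 1 (by omega)
    have hy : y.1 (n + 1) = y.1 1 := y.2 (n + 1) 1 (by omega)
    rw [hx, hy]
    exact h

/-- The limit at a product is the product of the limits. -/
def limProd (σ τ : TyExpr m) : Lim (.prod σ τ) ≃o Lim σ × Lim τ where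
  toFun x :=
    (⟨fun n => (show approx n σ × approx n τ from x.1 (n + 1)).1,
        fun n k h => congrArg Prod.fst (x.2 (n + 1) (k + 1) (by omega))⟩,
      ⟨fun n => (show approx n σ × approx n τ from x.1 (n + 1)).2,
        fun n k h => congrArg Prod.snd (x.2 (n + 1) (k + 1) (by omega))⟩)
  invFun p := Lim.succMk (fun n => (p.1.1 n, p.2.1 n)) fun n k h =>
    Prod.ext (p.1.2 n k h) (p.2.2 n k h)
  left_inv _ := Lim.ext fun _ => rfl
  right_inv _ := rfl
  map_rel_iff' := ⟨fun h => Lim.le_iff.2 fun n => ⟨h.1 n, h.2 n⟩,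
    fun h => ⟨fun n => (h (n + 1)).1, fun n => (h (n + 1)).2⟩⟩

/-- The limit at a recursive type is the limit at its unfolding: the approximations are shifted by one. -/
def limRec (τ : TyExpr (m + 1)) : Lim (.recty τ) ≃o Lim τ.unfolding where
  toFun x := ⟨fun n => x.1 (n + 1), fun n k h => x.2 (n + 1) (k + 1) (by omega)⟩
  invFun y := Lim.succMk y.1 fun n k h => y.2 n k h
  left_inv _ := Lim.ext fun _ => rfl
  right_inv _ := rfl
  map_rel_iff' := ⟨fun h => Lim.le_iff.2 h, fun h n => h (n + 1)⟩

/-- The threads of approximations at a sum type. -/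
def ofSum (σ τ : TyExpr m) : WithBot (Lim σ ⊕ Lim τ) → Lim (.sum σ τ)
  | none => Lim.succMk (fun _ => ⊥) fun _ _ _ => tr_bot _ _ _
  | some (Sum.inl x) => Lim.succMk (fun n => inlx τ (x.1 n)) fun n k h => by
      rw [tr_inlx, x.2 n k h]
  | some (Sum.inr x) => Lim.succMk (fun n => inrx σ (x.1 n)) fun n k h => by
      rw [tr_inrx, x.2 n k h]

theorem inlx_not_le_bot {n : ℕ} {σ τ : TyExpr m} (a : approx n σ) :
    ¬ (inlx τ a ≤ ⊥) := WithBot.not_coe_le_bot _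

theorem inrx_not_le_bot {n : ℕ} {σ τ : TyExpr m} (a : approx n τ) :
    ¬ (inrx σ a ≤ ⊥) := WithBot.not_coe_le_bot _

theorem not_inlx_le_inrx {n : ℕ} {σ τ : TyExpr m} (a : approx n σ) (b : approx n τ) :
    ¬ (inlx τ a ≤ inrx σ b) := fun h => Sum.not_inl_le_inr (WithBot.coe_le_coe.1 h)

theorem not_inrx_le_inlx {n : ℕ} {σ τ : TyExpr m} (a : approx n σ) (b : approx n τ) :
    ¬ (inrx σ b ≤ inlx τ a) := fun h => Sum.not_inr_le_inl (WithBot.coe_le_coe.1 h)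

theorem ofSum_le {σ τ : TyExpr m} (p q : WithBot (Lim σ ⊕ Lim τ)) :
    ofSum σ τ p ≤ ofSum σ τ q ↔ p ≤ q := by
  rcases p with _ | x | x
  · exact iff_of_true (Lim.le_iff.2 fun n => bot_le (α := approx (n + 1) (.sum σ τ))) bot_le
  · rcases q with _ | y | y
    · exact iff_of_false (fun h => inlx_not_le_bot _ (Lim.le_iff.1 h 0))
        (WithBot.not_coe_le_bot _)
    · refine Iff.trans ?_ (WithBot.coe_le_coe.trans Sum.inl_le_inl_iff).symm
      exact ⟨fun h n => inlx_le.1 (Lim.le_iff.1 h n), fun h => Lim.le_iff.2 fun n => inlx_le.2 (h n)⟩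
    · exact iff_of_false (fun h => not_inlx_le_inrx _ _ (Lim.le_iff.1 h 0))
        (fun h => Sum.not_inl_le_inr (WithBot.coe_le_coe.1 h))
  · rcases q with _ | y | y
    · exact iff_of_false (fun h => inrx_not_le_bot _ (Lim.le_iff.1 h 0))
        (WithBot.not_coe_le_bot _)
    · exact iff_of_false (fun h => not_inrx_le_inlx _ _ (Lim.le_iff.1 h 0))
        (fun h => Sum.not_inr_le_inl (WithBot.coe_le_coe.1 h))
    · refine Iff.trans ?_ (WithBot.coe_le_coe.trans Sum.inr_le_inr_iff).symm
      exact ⟨fun h n => inrx_le.1 (Lim.le_iff.1 h n), fun h => Lim.le_iff.2 fun n => inrx_le.2 (h n)⟩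

theorem inlx_inj {n : ℕ} {σ τ : TyExpr m} {a b : approx n σ} (h : inlx τ a = inlx τ b) : a = b :=
  le_antisymm (inlx_le.1 h.le) (inlx_le.1 h.ge)

theorem inrx_inj {n : ℕ} {σ τ : TyExpr m} {a b : approx n τ} (h : inrx σ a = inrx σ b) : a = b :=
  le_antisymm (inrx_le.1 h.le) (inrx_le.1 h.ge)

theorem ofSum_surjective (σ τ : TyExpr m) : Function.Surjective (ofSum σ τ) := by
  intro x
  have hx : ∀ n k, k ≤ n → tr (n + 1) (k + 1) _ (x.1 (n + 1)) = x.1 (k + 1) :=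
    fun n k h => x.2 (n + 1) (k + 1) (by omega)
  rcases sumx_cases (x.1 1) with h0 | ⟨a, h0⟩ | ⟨a, h0⟩
  · refine ⟨none, Lim.ext fun n => ?_⟩
    have := hx n 0 (Nat.zero_le n)
    rcases sumx_cases (x.1 (n + 1)) with h | ⟨b, h⟩ | ⟨b, h⟩
    · exact h.symm
    · rw [h, h0, tr_inlx] at this; exact absurd this.le (inlx_not_le_bot _)
    · rw [h, h0, tr_inrx] at this; exact absurd this.le (inrx_not_le_bot _)
  · have hall : ∀ n, ∃ b, x.1 (n + 1) = inlx τ b := by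
      intro n
      have := hx n 0 (Nat.zero_le n)
      rcases sumx_cases (x.1 (n + 1)) with h | h | ⟨b, h⟩
      · rw [h, h0, tr_bot] at this; exact absurd this.ge (inlx_not_le_bot _)
      · exact h
      · rw [h, h0, tr_inrx] at this; exact absurd this.le (not_inrx_le_inlx _ _)
    choose b hb using hall
    refine ⟨some (Sum.inl ⟨b, fun n k hk => ?_⟩), Lim.ext fun n => (hb n).symm⟩
    have := hx n k hk
    rw [hb, hb, tr_inlx] at this
    exact inlx_inj this
  · have hall : ∀ n, ∃ b, x.1 (n + 1) = inrx σ b := by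
      intro n
      have := hx n 0 (Nat.zero_le n)
      rcases sumx_cases (x.1 (n + 1)) with h | ⟨b, h⟩ | h
      · rw [h, h0, tr_bot] at this; exact absurd this.ge (inrx_not_le_bot _)
      · rw [h, h0, tr_inlx] at this; exact absurd this.le (not_inlx_le_inrx _ _)
      · exact h
    choose b hb using hall
    refine ⟨some (Sum.inr ⟨b, fun n k hk => ?_⟩), Lim.ext fun n => (hb n).symm⟩
    have := hx n k hk
    rw [hb, hb, tr_inrx] at this
    exact inrx_inj this

/-- The limit at a sum is the lifted sum of the limits. -/
def limSum (σ τ : TyExpr m) : Lim (.sum σ τ) ≃o WithBot (Lim σ ⊕ Lim τ) :=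
  (RelIso.ofSurjective (OrderEmbedding.ofMapLEIff (ofSum σ τ) ofSum_le)
    (ofSum_surjective σ τ)).symm

/-- The thread of finite approximations of a Scott-continuous function. -/
def ofScott (σ τ : TyExpr m) (g : ScottMap (Lim σ) (Lim τ)) : Lim (.arr σ τ) :=
  Lim.succMk (fun n => (⟨fun a => (g.1 (Lim.emb σ n a)).1 n,
      fun _ _ h => g.2.monotone (Lim.emb_mono n h) n⟩ : approx n σ →o approx n τ))
    fun n k h => apx_ext fun a => by
      refine (apx_tr n k σ τ _ a).trans ?_
      change tr n k τ ((g.1 (Lim.emb σ n (tr k n σ a))).1 n) = (g.1 (Lim.emb σ k a)).1 k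
      rw [(g.1 _).2 n k h]
      have : Lim.emb σ n (tr k n σ a) = Lim.emb σ k a :=
        Lim.val_injective (funext fun l => tr_tr (Or.inl h) σ a)
      rw [this]

theorem apx_ofScott {σ τ : TyExpr m} (g : ScottMap (Lim σ) (Lim τ)) (n : ℕ) (a : approx n σ) :
    apx ((ofScott σ τ g).1 (n + 1)) a = (g.1 (Lim.emb σ n a)).1 n := rfl

theorem ofScott_le {σ τ : TyExpr m} (g g' : ScottMap (Lim σ) (Lim τ)) :
    ofScott σ τ g ≤ ofScott σ τ g' ↔ g ≤ g' := by
  constructor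
  · intro h x
    have hlub := g.2 (Set.range_nonempty _) (Lim.directed_emb x) (Lim.isLUB_emb x)
    refine hlub.2 ?_
    rintro _ ⟨_, ⟨n, rfl⟩, rfl⟩ k
    let l := max n k
    have h1 : (g.1 (Lim.emb σ n (x.1 n))).1 l ≤ (g.1 (Lim.emb σ l (x.1 l))).1 l :=
      g.2.monotone (Lim.emb_le_emb x (le_max_left n k)) l
    have h2 : (g.1 (Lim.emb σ l (x.1 l))).1 l ≤ (g'.1 (Lim.emb σ l (x.1 l))).1 l :=
      Lim.le_iff.1 h l (x.1 l)
    have h3 : (g'.1 (Lim.emb σ l (x.1 l))).1 l ≤ (g'.1 x).1 l :=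
      g'.2.monotone (Lim.emb_le x l) l
    rw [← (g.1 _).2 l k (le_max_right n k), ← (g'.1 _).2 l k (le_max_right n k)]
    exact (tr l k τ).monotone (h1.trans (h2.trans h3))
  · exact fun h => Lim.le_iff.2 fun n a => h (Lim.emb σ n a) n

theorem ofScott_surjective (σ τ : TyExpr m) : Function.Surjective (ofScott σ τ) := by
  intro f
  let s : Lim σ → ℕ → ∀ n, approx n τ := fun x n k => tr n k τ (apx (f.1 (n + 1)) (x.1 n))
  have hs : ∀ x k, Monotone fun n => s x n k := fun x k => monotone_nat_of_le_succ fun n => by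
    change tr n k τ (apx (f.1 (n + 1)) (x.1 n)) ≤
      tr (n + 1) k τ (apx (f.1 (n + 1 + 1)) (x.1 (n + 1)))
    rw [← f.2 (n + 1 + 1) (n + 1) (by omega), apx_tr]
    refine (tr_tr_le _ _ _ _ _).trans ((tr (n + 1) k τ).monotone (apx_mono le_rfl ?_))
    rw [← x.2 (n + 1) n (by omega)]
    exact (tr_tr_le _ _ _ _ _).trans (tr_self _ _ _).le
  have hN : ∀ x k, ∃ N, ∀ n, N ≤ n → s x N k = s x n k := fun x k =>
    WellFoundedGT.monotone_chain_condition ⟨fun n => s x n k, hs x k⟩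
  choose N hN using hN
  have hle : ∀ x k n, s x n k ≤ s x (N x k) k := fun x k n => by
    rw [hN x k (max n (N x k)) (le_max_right _ _)]
    exact hs x k (le_max_left _ _)
  let g : Lim σ → Lim τ := fun x => ⟨fun k => s x (N x k) k, fun n k h => by
    rw [hN x n (max (N x n) (N x k)) (le_max_left _ _),
      hN x k (max (N x n) (N x k)) (le_max_right _ _)]
    exact tr_tr (Or.inr h) τ _⟩
  have hmono : Monotone g := fun x y h k =>
    ((tr _ k τ).monotone (apx_mono le_rfl (h _))).trans (hle y k (N x k))
  have hg : ScottContinuous g := by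
    intro d hn hd x hx
    refine ⟨?_, fun y hy k => ?_⟩
    · rintro _ ⟨z, hz, rfl⟩
      exact hmono (hx.1 hz)
    · obtain ⟨z, hz, hzx⟩ := Lim.exists_eq_of_isLUB hn hd hx (N x k)
      refine le_trans ?_ (hy ⟨z, hz, rfl⟩ k)
      change tr _ k τ (apx _ (x.1 (N x k))) ≤ _
      rw [← hzx]
      exact hle z k (N x k)
  refine ⟨⟨g, hg⟩, Lim.ext fun n => apx_ext fun a => ?_⟩
  refine (apx_ofScott _ n a).trans ?_
  change s (Lim.emb σ n a) (N _ n) n = _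
  rw [hN _ n (max (N (Lim.emb σ n a) n) n) (le_max_left _ _)]
  change tr _ n τ (apx (f.1 _) (tr n _ σ a)) = _
  rw [← apx_tr, f.2 _ _ (by omega)]

/-- The limit at an arrow type is the space of Scott-continuous functions between the limits. -/
def limArr (σ τ : TyExpr m) : Lim (.arr σ τ) ≃o ScottMap (Lim σ) (Lim τ) :=
  (RelIso.ofSurjective (OrderEmbedding.ofMapLEIff (ofScott σ τ) ofScott_le)
    (ofScott_surjective σ τ)).symm

end Iso

theorem orderIso_scottContinuous {X Y : Type} [PartialOrder X] [PartialOrder Y] (e : X ≃o Y) :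
    ScottContinuous e := fun _ _ _ _ h => e.isLUB_image'.2 h

/-- Order isomorphisms induce an order isomorphism of function spaces. -/
def scottCongr {X Y X' Y' : Type} [PartialOrder X] [PartialOrder Y] [PartialOrder X']
    [PartialOrder Y'] (e : X ≃o X') (e' : Y ≃o Y') : ScottMap X Y ≃o ScottMap X' Y' where
  toFun f := ⟨fun x => e' (f.1 (e.symm x)),
    ((orderIso_scottContinuous e.symm).comp f.2).comp (orderIso_scottContinuous e')⟩
  invFun f := ⟨fun x => e'.symm (f.1 (e x)),
    ((orderIso_scottContinuous e).comp f.2).comp (orderIso_scottContinuous e'.symm)⟩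
  left_inv f := ScottMap.val_injective (funext fun x => by simp)
  right_inv f := ScottMap.val_injective (funext fun x => by simp)
  map_rel_iff' {f g} := ⟨fun h x => by simpa using h (e x), fun h x => e'.monotone (h _)⟩

/-- Order isomorphisms induce an order isomorphism of products. -/
def prodCongr {X Y X' Y' : Type} [PartialOrder X] [PartialOrder Y] [PartialOrder X']
    [PartialOrder Y'] (e : X ≃o X') (e' : Y ≃o Y') : X × Y ≃o X' × Y' where
  toEquiv := e.toEquiv.prodCongr e'.toEquiv
  map_rel_iff' := and_congr e.le_iff_le e'.le_iff_le

/-- Every pure type is isomorphic to the limit of its finite approximations. -/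
def conv {m : ℕ} : (τ : TyExpr m) → Lim τ ≃o den τ
  | .var i => limVar i
  | .unit => limUnit
  | .prod σ τ => (limProd σ τ).trans (prodCongr (conv σ) (conv τ))
  | .arr σ τ => (limArr σ τ).trans (scottCongr (conv σ) (conv τ))
  | .sum σ τ => (limSum σ τ).trans (OrderIso.sumCongr (conv σ) (conv τ)).withBotCongr
  | .recty _ => OrderIso.refl _

/-- The isomorphism `⟦unfold⟧ : ⟦rec α. τ⟧ ≅ ⟦τ[rec α. τ / α]⟧`. -/
def unfold {m : ℕ} (τ : TyExpr (m + 1)) : den (.recty τ) ≃o den τ.unfolding :=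
  (limRec τ).trans (conv τ.unfolding)


/-! ### Formulae -/

/-- Iteration terms; iteration variables are de Bruijn indices, bound by the quantifiers. -/
inductive ITerm : Type
  | var : ℕ → ITerm
  | zero : ITerm
  | succ : ITerm → ITerm

namespace ITerm

def subst (s : ℕ → ITerm) : ITerm → ITerm
  | var k => s k
  | zero => zero
  | succ t => succ (subst s t)

def shift (t : ITerm) : ITerm := t.subst fun k => var (k + 1)

def eval (v : ℕ → ℕ) : ITerm → ℕ
  | var k => v k
  | zero => 0
  | succ t => eval v t + 1

/-- The iteration variable `k` occurs in the term. -/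
def Occurs (k : ℕ) : ITerm → Prop
  | var l => l = k
  | zero => False
  | succ t => Occurs k t

/-- The substitution `s` under one more binder. -/
def lift (s : ℕ → ITerm) : ℕ → ITerm
  | 0 => var 0
  | k + 1 => (s k).shift

/-- The substitution of `t` for the variable `0`. -/
def single (t : ITerm) : ℕ → ITerm
  | 0 => t
  | k + 1 => var k

end ITerm

/-- Fixpoint variables of type `τ` in a fixpoint context. -/
inductive FVar : List Ty → Ty → Type
  | head {E : List Ty} {τ : Ty} : FVar (τ :: E) τ
  | tail {E : List Ty} {σ τ : Ty} : FVar E τ → FVar (σ :: E) τ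

/-- The modalities `⟨π₁⟩, ⟨π₂⟩, ⟨in₁⟩, ⟨in₂⟩, ⟨fold⟩`: a `Modality σ τ` takes formulae of type `σ`
to formulae of type `τ`. -/
inductive Modality : Ty → Ty → Type
  | pi1 {σ τ : Ty} : Modality σ (.prod σ τ)
  | pi2 {σ τ : Ty} : Modality τ (.prod σ τ)
  | in1 {σ τ : Ty} : Modality σ (.sum σ τ)
  | in2 {σ τ : Ty} : Modality τ (.sum σ τ)
  | fold {τ : TyExpr 1} : Modality τ.unfolding (.recty τ)

/-- The modality is an injection. -/
def Modality.IsInj : {σ τ : Ty} → Modality σ τ → Prop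
  | _, _, .pi1 => False
  | _, _, .pi2 => False
  | _, _, .in1 => True
  | _, _, .in2 => True
  | _, _, .fold => False

/-- Raw formulae of type `τ` in a fixpoint context `E`, before polarities are taken into account.
`star` is `⟨⟨⟩⟩`, `finmu t φ` and `finnu t φ` are the bounded iterations `(μ^t X) φ` and `(ν^t X) φ`,
and `imp` is the realizability implication. -/
inductive Form : List Ty → Ty → Type
  | top {E : List Ty} {τ : Ty} : Form E τ
  | bot {E : List Ty} {τ : Ty} : Form E τ
  | and {E : List Ty} {τ : Ty} : Form E τ → Form E τ → Form E τ
  | or {E : List Ty} {τ : Ty} : Form E τ → Form E τ → Form E τ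
  | star {E : List Ty} : Form E .unit
  | modal {E : List Ty} {σ τ : Ty} : Modality σ τ → Form E σ → Form E τ
  | fvar {E : List Ty} {τ : Ty} : FVar E τ → Form E τ
  | finmu {E : List Ty} {τ : Ty} : ITerm → Form (τ :: E) τ → Form E τ
  | finnu {E : List Ty} {τ : Ty} : ITerm → Form (τ :: E) τ → Form E τ
  | ex {E : List Ty} {τ : Ty} : Form E τ → Form E τ
  | all {E : List Ty} {τ : Ty} : Form E τ → Form E τ
  | imp {E : List Ty} {σ τ : Ty} : Form [] σ → Form [] τ → Form E (.arr σ τ)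

namespace Form

/-- Substitution of iteration terms for iteration variables. -/
def isubst : {E : List Ty} → {τ : Ty} → (ℕ → ITerm) → Form E τ → Form E τ
  | _, _, _, top => top
  | _, _, _, bot => bot
  | _, _, s, and φ ψ => and (isubst s φ) (isubst s ψ)
  | _, _, s, or φ ψ => or (isubst s φ) (isubst s ψ)
  | _, _, _, star => star
  | _, _, s, modal m φ => modal m (isubst s φ)
  | _, _, _, fvar x => fvar x
  | _, _, s, finmu t φ => finmu (t.subst s) (isubst s φ)
  | _, _, s, finnu t φ => finnu (t.subst s) (isubst s φ)
  | _, _, s, ex φ => ex (isubst (ITerm.lift s) φ)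
  | _, _, s, all φ => all (isubst (ITerm.lift s) φ)
  | _, _, s, imp ψ φ => imp (isubst s ψ) (isubst s φ)

/-- `φ` seen under one more quantifier, which binds a variable that is not free in `φ`. -/
def ishift {E : List Ty} {τ : Ty} (φ : Form E τ) : Form E τ :=
  φ.isubst fun k => .var (k + 1)

/-- `φ[t / k]`, where `k` is the variable `0`. -/
def inst {E : List Ty} {τ : Ty} (φ : Form E τ) (t : ITerm) : Form E τ :=
  φ.isubst (ITerm.single t)

/-- A renaming of fixpoint variables under one more binder. -/
def liftRen {E E' : List Ty} {σ : Ty} (r : ∀ τ : Ty, FVar E τ → FVar E' τ) :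
    ∀ τ : Ty, FVar (σ :: E) τ → FVar (σ :: E') τ
  | _, .head => .head
  | _, .tail x => .tail (r _ x)

/-- Renaming of fixpoint variables. -/
def frename : {E E' : List Ty} → {τ : Ty} → (∀ τ : Ty, FVar E τ → FVar E' τ) →
    Form E τ → Form E' τ
  | _, _, _, _, top => top
  | _, _, _, _, bot => bot
  | _, _, _, r, and φ ψ => and (frename r φ) (frename r ψ)
  | _, _, _, r, or φ ψ => or (frename r φ) (frename r ψ)
  | _, _, _, _, star => star
  | _, _, _, r, modal m φ => modal m (frename r φ)
  | _, _, _, r, fvar x => fvar (r _ x)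
  | _, _, _, r, finmu t φ => finmu t (frename (liftRen r) φ)
  | _, _, _, r, finnu t φ => finnu t (frename (liftRen r) φ)
  | _, _, _, r, ex φ => ex (frename r φ)
  | _, _, _, r, all φ => all (frename r φ)
  | _, _, _, _, imp ψ φ => imp ψ φ

/-- A substitution for fixpoint variables under one more fixpoint binder. -/
def liftSub {E E' : List Ty} {σ : Ty} (s : ∀ τ : Ty, FVar E τ → Form E' τ) :
    ∀ τ : Ty, FVar (σ :: E) τ → Form (σ :: E') τ
  | _, .head => fvar .head
  | _, .tail x => (s _ x).frename fun _ y => .tail y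

/-- Capture-avoiding substitution of formulae for fixpoint variables. -/
def fsubst : {E E' : List Ty} → {τ : Ty} → (∀ τ : Ty, FVar E τ → Form E' τ) →
    Form E τ → Form E' τ
  | _, _, _, _, top => top
  | _, _, _, _, bot => bot
  | _, _, _, s, and φ ψ => and (fsubst s φ) (fsubst s ψ)
  | _, _, _, s, or φ ψ => or (fsubst s φ) (fsubst s ψ)
  | _, _, _, _, star => star
  | _, _, _, s, modal m φ => modal m (fsubst s φ)
  | _, _, _, s, fvar x => s _ x
  | _, _, _, s, finmu t φ => finmu t (fsubst (liftSub s) φ)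
  | _, _, _, s, finnu t φ => finnu t (fsubst (liftSub s) φ)
  | _, _, _, s, ex φ => ex (fsubst (fun τ x => (s τ x).ishift) φ)
  | _, _, _, s, all φ => all (fsubst (fun τ x => (s τ x).ishift) φ)
  | _, _, _, _, imp ψ φ => imp ψ φ

/-- The substitution of `ψ` for the first fixpoint variable. -/
def singleSub {E : List Ty} {σ : Ty} (ψ : Form E σ) : ∀ τ : Ty, FVar (σ :: E) τ → Form E τ
  | _, .head => ψ
  | _, .tail x => fvar x

/-- `φ[ψ / X]`, where `X` is the first fixpoint variable. -/
def finst {E : List Ty} {σ τ : Ty} (φ : Form (σ :: E) τ) (ψ : Form E σ) : Form E τ :=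
  φ.fsubst (singleSub ψ)

/-- The iteration variable `k` is free in the formula. -/
def Occurs : {E : List Ty} → {τ : Ty} → ℕ → Form E τ → Prop
  | _, _, _, top => False
  | _, _, _, bot => False
  | _, _, k, and φ ψ => Occurs k φ ∨ Occurs k ψ
  | _, _, k, or φ ψ => Occurs k φ ∨ Occurs k ψ
  | _, _, _, star => False
  | _, _, k, modal _ φ => Occurs k φ
  | _, _, _, fvar _ => False
  | _, _, k, finmu t φ => t.Occurs k ∨ Occurs k φ
  | _, _, k, finnu t φ => t.Occurs k ∨ Occurs k φ
  | _, _, k, ex φ => Occurs (k + 1) φ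
  | _, _, k, all φ => Occurs (k + 1) φ
  | _, _, k, imp ψ φ => Occurs k ψ ∨ Occurs k φ

/-- Finite conjunctions; the empty one is `⊤`. -/
def bigAnd {E : List Ty} {τ : Ty} : List (Form E τ) → Form E τ
  | [] => top
  | φ :: l => and φ (bigAnd l)

end Form

open Form

mutual
/-- The iteration variable `k` occurs only positively. -/
inductive Pos : {E : List Ty} → {τ : Ty} → ℕ → Form E τ → Prop
  | fresh {E : List Ty} {τ : Ty} {k : ℕ} {φ : Form E τ} : ¬ φ.Occurs k → Pos k φ
  | and {E : List Ty} {τ : Ty} {k : ℕ} {φ ψ : Form E τ} : Pos k φ → Pos k ψ → Pos k (and φ ψ)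
  | or {E : List Ty} {τ : Ty} {k : ℕ} {φ ψ : Form E τ} : Pos k φ → Pos k ψ → Pos k (or φ ψ)
  | modal {E : List Ty} {σ τ : Ty} {k : ℕ} {m : Modality σ τ} {φ : Form E σ} :
      Pos k φ → Pos k (modal m φ)
  | imp {E : List Ty} {σ τ : Ty} {k : ℕ} {ψ : Form [] σ} {φ : Form [] τ} :
      Neg k ψ → Pos k φ → Pos k (imp ψ φ : Form E (.arr σ τ))
  | ex {E : List Ty} {τ : Ty} {k : ℕ} {φ : Form E τ} : Pos (k + 1) φ → Pos k (ex φ)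
  | finmu {E : List Ty} {τ : Ty} {k : ℕ} {t : ITerm} {φ : Form (τ :: E) τ} :
      Pos k φ → Pos k (finmu t φ)
  | finnu {E : List Ty} {τ : Ty} {k : ℕ} {t : ITerm} {φ : Form (τ :: E) τ} :
      Pos k φ → ¬ t.Occurs k → Pos k (finnu t φ)
/-- The iteration variable `k` occurs only negatively. -/
inductive Neg : {E : List Ty} → {τ : Ty} → ℕ → Form E τ → Prop
  | fresh {E : List Ty} {τ : Ty} {k : ℕ} {φ : Form E τ} : ¬ φ.Occurs k → Neg k φ
  | and {E : List Ty} {τ : Ty} {k : ℕ} {φ ψ : Form E τ} : Neg k φ → Neg k ψ → Neg k (and φ ψ)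
  | or {E : List Ty} {τ : Ty} {k : ℕ} {φ ψ : Form E τ} : Neg k φ → Neg k ψ → Neg k (or φ ψ)
  | modal {E : List Ty} {σ τ : Ty} {k : ℕ} {m : Modality σ τ} {φ : Form E σ} :
      Neg k φ → Neg k (modal m φ)
  | imp {E : List Ty} {σ τ : Ty} {k : ℕ} {ψ : Form [] σ} {φ : Form [] τ} :
      Pos k ψ → Neg k φ → Neg k (imp ψ φ : Form E (.arr σ τ))
  | all {E : List Ty} {τ : Ty} {k : ℕ} {φ : Form E τ} : Neg (k + 1) φ → Neg k (all φ)
  | finnu {E : List Ty} {τ : Ty} {k : ℕ} {t : ITerm} {φ : Form (τ :: E) τ} :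
      Neg k φ → Neg k (finnu t φ)
  | finmu {E : List Ty} {τ : Ty} {k : ℕ} {t : ITerm} {φ : Form (τ :: E) τ} :
      Neg k φ → ¬ t.Occurs k → Neg k (finmu t φ)
end

/-- Polarities: neutral, positive and negative. -/
inductive Sgn : Type
  | neutral
  | pos
  | neg

/-- The opposite polarity. -/
def Sgn.opp : Sgn → Sgn
  | neutral => neutral
  | pos => neg
  | neg => pos

/-- `Lang s φ` says that `φ` belongs to the language of formulae of polarity `s`. -/
inductive Lang : Sgn → {E : List Ty} → {τ : Ty} → Form E τ → Prop
  | top {s : Sgn} {E : List Ty} {τ : Ty} : Lang s (top : Form E τ)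
  | bot {s : Sgn} {E : List Ty} {τ : Ty} : Lang s (bot : Form E τ)
  | and {s : Sgn} {E : List Ty} {τ : Ty} {φ ψ : Form E τ} :
      Lang s φ → Lang s ψ → Lang s (and φ ψ)
  | or {s : Sgn} {E : List Ty} {τ : Ty} {φ ψ : Form E τ} :
      Lang s φ → Lang s ψ → Lang s (or φ ψ)
  | star {s : Sgn} {E : List Ty} : Lang s (star : Form E .unit)
  | modal {s : Sgn} {E : List Ty} {σ τ : Ty} {m : Modality σ τ} {φ : Form E σ} :
      Lang s φ → Lang s (modal m φ)
  | fvar {s : Sgn} {E : List Ty} {τ : Ty} (x : FVar E τ) : Lang s (fvar x)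
  | finmu {s : Sgn} {E : List Ty} {τ : Ty} {t : ITerm} {φ : Form (τ :: E) τ} :
      Lang s φ → Lang s (finmu t φ)
  | finnu {s : Sgn} {E : List Ty} {τ : Ty} {t : ITerm} {φ : Form (τ :: E) τ} :
      Lang s φ → Lang s (finnu t φ)
  | ex {E : List Ty} {τ : Ty} {φ : Form E τ} : Lang .pos φ → Pos 0 φ → Lang .pos (ex φ)
  | all {E : List Ty} {τ : Ty} {φ : Form E τ} : Lang .neg φ → Neg 0 φ → Lang .neg (all φ)
  | imp {s : Sgn} {E : List Ty} {σ τ : Ty} {ψ : Form [] σ} {φ : Form [] τ} :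
      Lang s.opp ψ → Lang s φ → Lang s (imp ψ φ : Form E (.arr σ τ))

/-- The conjunctive formulae: no disjunction, no bounded iteration, no quantifier (hence no fixpoint
and no iteration variable). -/
inductive IsConj : {τ : Ty} → Form [] τ → Prop
  | top {τ : Ty} : IsConj (top : Form [] τ)
  | bot {τ : Ty} : IsConj (bot : Form [] τ)
  | and {τ : Ty} {φ ψ : Form [] τ} : IsConj φ → IsConj ψ → IsConj (and φ ψ)
  | star : IsConj star
  | modal {σ τ : Ty} {m : Modality σ τ} {φ : Form [] σ} : IsConj φ → IsConj (modal m φ)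
  | imp {σ τ : Ty} {ψ : Form [] σ} {φ : Form [] τ} : IsConj ψ → IsConj φ → IsConj (imp ψ φ)

/-! ### Deduction -/

/-- `ψ ⊢ φ` is a sequent if both formulae belong to the language of one and the same polarity. -/
def IsSequent {E : List Ty} {τ : Ty} (ψ φ : Form E τ) : Prop :=
  ∃ s : Sgn, Lang s ψ ∧ Lang s φ

mutual
/-- `Ded ψ φ`: the sequent `ψ ⊢ φ` is derivable.  Side conditions `k ∉ FV(θ)` are expressed by
writing `θ.ishift` under the binder of `k`. -/
inductive Ded : {E : List Ty} → {τ : Ty} → Form E τ → Form E τ → Prop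
  -- propositional rules
  | refl {E : List Ty} {τ : Ty} {φ : Form E τ} : IsSequent φ φ → Ded φ φ
  | cut {E : List Ty} {τ : Ty} {ψ θ φ : Form E τ} : IsSequent ψ φ → Ded ψ θ → Ded θ φ → Ded ψ φ
  | distrib {E : List Ty} {τ : Ty} {ψ φ θ : Form E τ} :
      IsSequent (and ψ (or φ θ)) (or (and ψ φ) (and ψ θ)) →
      Ded (and ψ (or φ θ)) (or (and ψ φ) (and ψ θ))
  | andR {E : List Ty} {τ : Ty} {ψ φ₁ φ₂ : Form E τ} : IsSequent ψ (and φ₁ φ₂) →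
      Ded ψ φ₁ → Ded ψ φ₂ → Ded ψ (and φ₁ φ₂)
  | andL₁ {E : List Ty} {τ : Ty} {ψ₁ ψ₂ φ : Form E τ} : IsSequent (and ψ₁ ψ₂) φ →
      Ded ψ₁ φ → Ded (and ψ₁ ψ₂) φ
  | andL₂ {E : List Ty} {τ : Ty} {ψ₁ ψ₂ φ : Form E τ} : IsSequent (and ψ₁ ψ₂) φ →
      Ded ψ₂ φ → Ded (and ψ₁ ψ₂) φ
  | topR {E : List Ty} {τ : Ty} {ψ : Form E τ} : IsSequent ψ top → Ded ψ top
  | orR₁ {E : List Ty} {τ : Ty} {ψ φ₁ φ₂ : Form E τ} : IsSequent ψ (or φ₁ φ₂) →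
      Ded ψ φ₁ → Ded ψ (or φ₁ φ₂)
  | orR₂ {E : List Ty} {τ : Ty} {ψ φ₁ φ₂ : Form E τ} : IsSequent ψ (or φ₁ φ₂) →
      Ded ψ φ₂ → Ded ψ (or φ₁ φ₂)
  | orL {E : List Ty} {τ : Ty} {ψ₁ ψ₂ φ : Form E τ} : IsSequent (or ψ₁ ψ₂) φ →
      Ded ψ₁ φ → Ded ψ₂ φ → Ded (or ψ₁ ψ₂) φ
  | botL {E : List Ty} {τ : Ty} {φ : Form E τ} : IsSequent bot φ → Ded bot φ
  -- modal rules
  | injDisj {E : List Ty} {σ τ : Ty} {φ : Form E σ} {ψ : Form E τ} :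
      IsSequent (and (modal .in1 φ) (modal .in2 ψ)) bot →
      Ded (and (modal .in1 φ) (modal .in2 ψ)) bot
  | modalMono {E : List Ty} {σ τ : Ty} {m : Modality σ τ} {ψ φ : Form E σ} :
      IsSequent (modal m ψ) (modal m φ) → Ded ψ φ → Ded (modal m ψ) (modal m φ)
  | impMono {E : List Ty} {σ τ : Ty} {ψ ψ' : Form [] σ} {φ φ' : Form [] τ} :
      IsSequent (imp ψ φ : Form E (.arr σ τ)) (imp ψ' φ') →
      Ded ψ' ψ → Ded φ φ' → Ded (imp ψ φ : Form E (.arr σ τ)) (imp ψ' φ')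
  | modalAnd {E : List Ty} {σ τ : Ty} {m : Modality σ τ} {φ₁ φ₂ : Form E σ} :
      IsSequent (and (modal m φ₁) (modal m φ₂)) (modal m (and φ₁ φ₂)) →
      Ded (and (modal m φ₁) (modal m φ₂)) (modal m (and φ₁ φ₂))
  | modalTop {E : List Ty} {σ τ : Ty} {m : Modality σ τ} : ¬ m.IsInj →
      IsSequent (top : Form E τ) (modal m top) → Ded (top : Form E τ) (modal m top)
  | modalAll {E : List Ty} {σ τ : Ty} {m : Modality σ τ} {φ : Form E σ} :
      IsSequent (all (modal m φ)) (modal m (all φ)) → Ded (all (modal m φ)) (modal m (all φ))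
  | modalOr {E : List Ty} {σ τ : Ty} {m : Modality σ τ} {φ₁ φ₂ : Form E σ} :
      IsSequent (modal m (or φ₁ φ₂)) (or (modal m φ₁) (modal m φ₂)) →
      Ded (modal m (or φ₁ φ₂)) (or (modal m φ₁) (modal m φ₂))
  | modalBot {E : List Ty} {σ τ : Ty} {m : Modality σ τ} :
      IsSequent (modal m bot : Form E τ) bot → Ded (modal m bot : Form E τ) bot
  | modalEx {E : List Ty} {σ τ : Ty} {m : Modality σ τ} {φ : Form E σ} :
      IsSequent (modal m (ex φ)) (ex (modal m φ)) → Ded (modal m (ex φ)) (ex (modal m φ))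
  -- quantifier rules
  | exR {E : List Ty} {τ : Ty} {ψ φ : Form E τ} (t : ITerm) : IsSequent ψ (ex φ) →
      Ded ψ (φ.inst t) → Ded ψ (ex φ)
  | exL {E : List Ty} {τ : Ty} {θ φ ψ : Form E τ} : IsSequent (and θ (ex φ)) ψ →
      Ded (and θ.ishift φ) ψ.ishift → Ded (and θ (ex φ)) ψ
  | exMerge {E : List Ty} {τ : Ty} {φ : Form E τ} :
      IsSequent (ex (ex φ)) (ex (φ.inst (.var 0))) → Ded (ex (ex φ)) (ex (φ.inst (.var 0)))
  | allL {E : List Ty} {τ : Ty} {φ ψ : Form E τ} (t : ITerm) : IsSequent (all φ) ψ →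
      Ded (φ.inst t) ψ → Ded (all φ) ψ
  | allR {E : List Ty} {τ : Ty} {ψ φ θ : Form E τ} : IsSequent ψ (or (all φ) θ) →
      Ded ψ.ishift (or φ θ.ishift) → Ded ψ (or (all φ) θ)
  | allMerge {E : List Ty} {τ : Ty} {φ : Form E τ} :
      IsSequent (all (φ.inst (.var 0))) (all (all φ)) → Ded (all (φ.inst (.var 0))) (all (all φ))
  | finmuEx {E : List Ty} {τ : Ty} {t : ITerm} {φ : Form (τ :: E) τ} :
      IsSequent (finmu t (ex φ)) (ex (finmu t.shift φ)) →
      Ded (finmu t (ex φ)) (ex (finmu t.shift φ))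
  | finnuEx {E : List Ty} {τ : Ty} {t : ITerm} {φ : Form (τ :: E) τ} :
      IsSequent (finnu t (ex φ)) (ex (finnu t.shift φ)) →
      Ded (finnu t (ex φ)) (ex (finnu t.shift φ))
  | allFinmu {E : List Ty} {τ : Ty} {t : ITerm} {φ : Form (τ :: E) τ} :
      IsSequent (all (finmu t.shift φ)) (finmu t (all φ)) →
      Ded (all (finmu t.shift φ)) (finmu t (all φ))
  | allFinnu {E : List Ty} {τ : Ty} {t : ITerm} {φ : Form (τ :: E) τ} :
      IsSequent (all (finnu t.shift φ)) (finnu t (all φ)) →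
      Ded (all (finnu t.shift φ)) (finnu t (all φ))
  -- bounded iteration
  | finmuZero {E : List Ty} {τ : Ty} {φ : Form (τ :: E) τ} :
      IsSequent (finmu .zero φ) bot → Ded (finmu .zero φ) bot
  | finmuSuccL {E : List Ty} {τ : Ty} {t : ITerm} {φ : Form (τ :: E) τ} {ψ : Form E τ} :
      IsSequent (finmu (.succ t) φ) (φ.finst ψ) →
      Ded (finmu t φ) ψ → Ded (finmu (.succ t) φ) (φ.finst ψ)
  | finmuSuccR {E : List Ty} {τ : Ty} {t : ITerm} {φ : Form (τ :: E) τ} :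
      IsSequent (φ.finst (finmu t φ)) (finmu (.succ t) φ) →
      Ded (φ.finst (finmu t φ)) (finmu (.succ t) φ)
  | finmuMono {E : List Ty} {τ : Ty} {t : ITerm} {ψ φ : Form (τ :: E) τ} :
      IsSequent (finmu t ψ) (finmu t φ) → Ded ψ φ → Ded (finmu t ψ) (finmu t φ)
  | finnuZero {E : List Ty} {τ : Ty} {φ : Form (τ :: E) τ} :
      IsSequent top (finnu .zero φ) → Ded top (finnu .zero φ)
  | finnuSuccR {E : List Ty} {τ : Ty} {t : ITerm} {φ : Form (τ :: E) τ} {ψ : Form E τ} :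
      IsSequent (φ.finst ψ) (finnu (.succ t) φ) →
      Ded ψ (finnu t φ) → Ded (φ.finst ψ) (finnu (.succ t) φ)
  | finnuSuccL {E : List Ty} {τ : Ty} {t : ITerm} {φ : Form (τ :: E) τ} :
      IsSequent (finnu (.succ t) φ) (φ.finst (finnu t φ)) →
      Ded (finnu (.succ t) φ) (φ.finst (finnu t φ))
  | finnuMono {E : List Ty} {τ : Ty} {t : ITerm} {ψ φ : Form (τ :: E) τ} :
      IsSequent (finnu t ψ) (finnu t φ) → Ded ψ φ → Ded (finnu t ψ) (finnu t φ)
  -- realizability implication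
  | impWF {E : List Ty} {σ τ : Ty} {ψ : Form [] σ} {φ : Form [] τ} :
      IsSequent (imp (all ψ) φ : Form E (.arr σ τ)) (ex (imp ψ φ.ishift)) →
      Ded (imp (all ψ) φ : Form E (.arr σ τ)) (ex (imp ψ φ.ishift))
  | impCC {E : List Ty} {σ τ : Ty} {ψ : Form [] σ} {φ : Form [] τ} : Lang .neutral ψ →
      IsSequent (imp ψ (ex φ) : Form E (.arr σ τ)) (ex (imp ψ.ishift φ)) →
      Ded (imp ψ (ex φ) : Form E (.arr σ τ)) (ex (imp ψ.ishift φ))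
  | exImp {E : List Ty} {σ τ : Ty} {ψ : Form [] σ} {φ : Form [] τ} :
      IsSequent (all (imp ψ φ.ishift) : Form E (.arr σ τ)) (imp (ex ψ) φ) →
      Ded (all (imp ψ φ.ishift) : Form E (.arr σ τ)) (imp (ex ψ) φ)
  | impAll {E : List Ty} {σ τ : Ty} {ψ : Form [] σ} {φ : Form [] τ} :
      IsSequent (all (imp ψ.ishift φ) : Form E (.arr σ τ)) (imp ψ (all φ)) →
      Ded (all (imp ψ.ishift φ) : Form E (.arr σ τ)) (imp ψ (all φ))
  | impAnd {E : List Ty} {σ τ : Ty} {ψ : Form [] σ} {φ₁ φ₂ : Form [] τ} :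
      IsSequent (and (imp ψ φ₁) (imp ψ φ₂) : Form E (.arr σ τ)) (imp ψ (and φ₁ φ₂)) →
      Ded (and (imp ψ φ₁) (imp ψ φ₂) : Form E (.arr σ τ)) (imp ψ (and φ₁ φ₂))
  | impTop {E : List Ty} {σ τ : Ty} {ψ : Form [] σ} :
      IsSequent (top : Form E (.arr σ τ)) (imp ψ top) →
      Ded (top : Form E (.arr σ τ)) (imp ψ top)
  | orImp {E : List Ty} {σ τ : Ty} {ψ₁ ψ₂ : Form [] σ} {φ : Form [] τ} :
      IsSequent (and (imp ψ₁ φ) (imp ψ₂ φ) : Form E (.arr σ τ)) (imp (or ψ₁ ψ₂) φ) →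
      Ded (and (imp ψ₁ φ) (imp ψ₂ φ) : Form E (.arr σ τ)) (imp (or ψ₁ ψ₂) φ)
  | botImp {E : List Ty} {σ τ : Ty} {φ : Form [] τ} :
      IsSequent (top : Form E (.arr σ τ)) (imp bot φ) →
      Ded (top : Form E (.arr σ τ)) (imp bot φ)
  | impOr {E : List Ty} {σ τ : Ty} {δ : Form [] σ} {φ₁ φ₂ : Form [] τ} : IsConj δ →
      IsSequent (imp δ (or φ₁ φ₂) : Form E (.arr σ τ)) (or (imp δ φ₁) (imp δ φ₂)) →
      Ded (imp δ (or φ₁ φ₂) : Form E (.arr σ τ)) (or (imp δ φ₁) (imp δ φ₂))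
  | impBot {E : List Ty} {σ τ : Ty} {δ : Form [] σ} : Cons δ → IsConj δ →
      IsSequent (imp δ bot : Form E (.arr σ τ)) bot →
      Ded (imp δ bot : Form E (.arr σ τ)) bot
/-- The consistency predicate `C(φ)`, on conjunctive formulae. -/
inductive Cons : {τ : Ty} → Form [] τ → Prop
  | star : Cons star
  | fold {τ : TyExpr 1} {φ : Form [] τ.unfolding} : Cons φ → Cons (modal .fold φ)
  | pair {σ τ : Ty} {φ : Form [] σ} {ψ : Form [] τ} : Cons φ → Cons ψ →
      Cons (and (modal .pi1 φ) (modal .pi2 ψ))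
  | in1 {σ τ : Ty} {φ : Form [] σ} : Cons φ → Cons (modal (.in1 : Modality σ (.sum σ τ)) φ)
  | in2 {σ τ : Ty} {φ : Form [] τ} : Cons φ → Cons (modal (.in2 : Modality τ (.sum σ τ)) φ)
  | top {τ : Ty} : Cons (top : Form [] τ)
  | ded {τ : Ty} {ψ φ : Form [] τ} : Cons ψ → Ded ψ φ → IsConj φ → Cons φ
  | imp {σ τ : Ty} (I : List (Form [] σ × Form [] τ)) :
      (∀ p ∈ I, Cons p.1) → (∀ p ∈ I, Cons p.2) → (∀ J, J.Sublist I → Coherent J) →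
      Cons (bigAnd (I.map fun p => imp p.1 p.2))
/-- For a finite family `J` of pairs `(ψ, φ)`: either `⋀ ψ ⊢ ⊥` is derivable, or `C(⋀ φ)` is. -/
inductive Coherent : {σ τ : Ty} → List (Form [] σ × Form [] τ) → Prop
  | incons {σ τ : Ty} {J : List (Form [] σ × Form [] τ)} :
      Ded (bigAnd (J.map Prod.fst)) bot → Coherent J
  | cons {σ τ : Ty} {J : List (Form [] σ × Form [] τ)} :
      Cons (bigAnd (J.map Prod.snd)) → Coherent J
end

/-! ### Semantics of formulae -/

/-- The semantic modalities. -/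
def Modality.sem : {σ τ : Ty} → Modality σ τ → Set (den σ) → Set (den τ)
  | _, _, @Modality.pi1 σ τ, S => {x : den σ × den τ | x.1 ∈ S}
  | _, _, @Modality.pi2 σ τ, S => {x : den σ × den τ | x.2 ∈ S}
  | _, _, @Modality.in1 σ τ, S =>
      (fun x : den σ => ((Sum.inl x : den σ ⊕ den τ) : WithBot (den σ ⊕ den τ))) '' S
  | _, _, @Modality.in2 σ τ, S =>
      (fun x : den τ => ((Sum.inr x : den σ ⊕ den τ) : WithBot (den σ ⊕ den τ))) '' S
  | _, _, @Modality.fold τ, S => {x : den (.recty τ) | unfold τ x ∈ S}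

/-- Valuations of the fixpoint variables of a context. -/
abbrev Val (E : List Ty) : Type := ∀ σ : Ty, FVar E σ → Set (den σ)

def Val.nil : Val [] := fun _ x => nomatch x

def Val.cons {E : List Ty} {σ : Ty} (S : Set (den σ)) (ρ : Val E) : Val (σ :: E)
  | _, .head => S
  | _, .tail x => ρ _ x

/-- Extension of a valuation of the iteration variables at index `0`. -/
def consI (n : ℕ) (v : ℕ → ℕ) : ℕ → ℕ
  | 0 => n
  | k + 1 => v k

/-- The interpretation of a formula under a valuation. -/
def Form.sem : {E : List Ty} → {τ : Ty} → Form E τ → Val E → (ℕ → ℕ) → Set (den τ)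
  | _, _, .top, _, _ => Set.univ
  | _, _, .bot, _, _ => ∅
  | _, _, .and φ ψ, ρ, v => φ.sem ρ v ∩ ψ.sem ρ v
  | _, _, .or φ ψ, ρ, v => φ.sem ρ v ∪ ψ.sem ρ v
  | _, _, .star, _, _ => ({true} : Set Bool)
  | _, _, .modal m φ, ρ, v => m.sem (φ.sem ρ v)
  | _, _, .fvar x, ρ, _ => ρ _ x
  | _, _, .finmu t φ, ρ, v => (fun S => φ.sem (Val.cons S ρ) v)^[t.eval v] ∅
  | _, _, .finnu t φ, ρ, v => (fun S => φ.sem (Val.cons S ρ) v)^[t.eval v] Set.univ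
  | _, _, .ex φ, ρ, v => ⋃ n : ℕ, φ.sem ρ (consI n v)
  | _, _, .all φ, ρ, v => ⋂ n : ℕ, φ.sem ρ (consI n v)
  | _, _, @Form.imp _ σ τ ψ φ, _, v =>
      {f : ScottMap (den σ) (den τ) | ∀ x ∈ ψ.sem Val.nil v, f.val x ∈ φ.sem Val.nil v}

end PosLog

end

noncomputable section
namespace PosLog
open Form

/-! ### Directed completeness of the interpretations of types -/

theorem Lim.exists_isLUB {m : ℕ} {τ : TyExpr m} {d : Set (Lim τ)} (hn : d.Nonempty)
    (hd : DirectedOn (· ≤ ·) d) : ∃ x, IsLUB d x := by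
  -- Each approximation is finite, so a directed set attains a greatest value in every coordinate;
  -- these values form the thread of the supremum.
  have hmax : ∀ n, ∃ y ∈ d, ∀ z ∈ d, z.1 n ≤ y.1 n := by
    intro n
    obtain ⟨a, ⟨y, hy, rfl⟩, ha⟩ :=
      (Set.toFinite ((fun z : Lim τ => z.1 n) '' d)).exists_maximal (hn.image _)
    refine ⟨y, hy, fun z hz => ?_⟩
    obtain ⟨w, hw, hyw, hzw⟩ := hd y hy z hz
    exact (hzw n).trans (ha ⟨w, hw, rfl⟩ (hyw n))
  choose w hw hmw using hmax
  exact ⟨⟨fun n => (w n).1 n, fun n k hk => le_antisymm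
    (((w n).2 n k hk).trans_le (hmw k _ (hw n)))
    (((w k).2 n k hk).symm.trans_le ((tr n k τ).monotone (hmw n _ (hw k))))⟩,
    fun z hz n => hmw n z hz, fun y hy n => hy (hw n) n⟩

theorem directedOn_image {X Y : Type} [PartialOrder X] [PartialOrder Y] {f : X → Y}
    (hf : Monotone f) {d : Set X} (hd : DirectedOn (· ≤ ·) d) :
    DirectedOn (· ≤ ·) (f '' d) := by
  rintro _ ⟨x, hx, rfl⟩ _ ⟨y, hy, rfl⟩
  obtain ⟨z, hz, hxz, hyz⟩ := hd x hx y hy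
  exact ⟨_, ⟨z, hz, rfl⟩, hf hxz, hf hyz⟩

theorem den_exists_isLUB {m : ℕ} (τ : TyExpr m) {d : Set (den τ)} (hn : d.Nonempty)
    (hd : DirectedOn (· ≤ ·) d) : ∃ x, IsLUB d x := by
  obtain ⟨x, hx⟩ := Lim.exists_isLUB (hn.image (conv τ).symm)
    (directedOn_image (conv τ).symm.monotone hd)
  exact ⟨conv τ x, ((conv τ).symm.isLUB_image).1 hx⟩

theorem den_exists_isBot {m : ℕ} (τ : TyExpr m) : ∃ x : den τ, IsBot x := by
  -- Transition maps out of level `0` are constantly `⊥`, so this thread is `⊥` in every coordinate.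
  refine ⟨conv τ (Lim.emb τ 0 ⊥), fun y => ?_⟩
  rw [← (conv τ).symm.le_iff_le, OrderIso.symm_apply_apply]
  exact fun k => bot_le

/-- Directed suprema of Scott-continuous functions are pointwise. -/
theorem ScottMap.isLUB_apply {X Y : Type} [PartialOrder X] [PartialOrder Y]
    (hY : ∀ d : Set Y, d.Nonempty → DirectedOn (· ≤ ·) d → ∃ y, IsLUB d y)
    {d : Set (ScottMap X Y)} (hn : d.Nonempty) (hd : DirectedOn (· ≤ ·) d) {f : ScottMap X Y}
    (hf : IsLUB d f) (a : X) : IsLUB ((fun g : ScottMap X Y => g.val a) '' d) (f.val a) := by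
  have hmono : ∀ x : X, Monotone fun g : ScottMap X Y => g.val x := fun x g h hgh => hgh x
  have hex : ∀ x : X, ∃ y, IsLUB ((fun g : ScottMap X Y => g.val x) '' d) y := fun x =>
    hY _ (hn.image _) (directedOn_image (hmono x) hd)
  choose u hu using hex
  -- Interchanging the two suprema shows that the pointwise supremum `u` is continuous. It is
  -- therefore the supremum in the function space, and equals `f` by uniqueness.
  have hcont : ScottContinuous u := by
    intro s hs hsd x hx
    refine ⟨?_, fun y hy => (hu x).2 ?_⟩
    · rintro _ ⟨z, hz, rfl⟩
      refine (hu z).2 ?_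
      rintro _ ⟨g, hg, rfl⟩
      exact (g.property.monotone (hx.1 hz)).trans ((hu x).1 ⟨g, hg, rfl⟩)
    · rintro _ ⟨g, hg, rfl⟩
      refine (g.property hs hsd hx).2 ?_
      rintro _ ⟨z, hz, rfl⟩
      exact ((hu z).1 ⟨g, hg, rfl⟩).trans (hy ⟨z, hz, rfl⟩)
  have hlub : IsLUB d (⟨u, hcont⟩ : ScottMap X Y) :=
    ⟨fun g hg x => (hu x).1 ⟨g, hg, rfl⟩, fun g hg x => (hu x).2 (by
      rintro _ ⟨h, hh, rfl⟩
      exact hg hh x)⟩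
  rw [← hlub.unique hf]
  exact hu a

/-! ### Scott-open sets -/

/-- Scott-open sets. -/
structure IsScottOpen {X : Type} [PartialOrder X] (S : Set X) : Prop where
  upper : IsUpperSet S
  inaccessible : ∀ d : Set X, d.Nonempty → DirectedOn (· ≤ ·) d → ∀ x, IsLUB d x → x ∈ S →
    ∃ z ∈ d, z ∈ S

namespace IsScottOpen

variable {X Y : Type} [PartialOrder X] [PartialOrder Y]

theorem univ : IsScottOpen (Set.univ : Set X) :=
  ⟨isUpperSet_univ, fun _ hn _ _ _ _ => hn.imp fun _ h => ⟨h, trivial⟩⟩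

theorem empty : IsScottOpen (∅ : Set X) := ⟨isUpperSet_empty, fun _ _ _ _ _ h => h.elim⟩

theorem inter {S T : Set X} (hS : IsScottOpen S) (hT : IsScottOpen T) : IsScottOpen (S ∩ T) := by
  refine ⟨hS.upper.inter hT.upper, fun d hn hd x hx h => ?_⟩
  obtain ⟨y, hy, hyS⟩ := hS.inaccessible d hn hd x hx h.1
  obtain ⟨z, hz, hzT⟩ := hT.inaccessible d hn hd x hx h.2
  obtain ⟨w, hw, hyw, hzw⟩ := hd y hy z hz
  exact ⟨w, hw, hS.upper hyw hyS, hT.upper hzw hzT⟩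

theorem preimage {f : X → Y} (hf : ScottContinuous f) {S : Set Y} (hS : IsScottOpen S) :
    IsScottOpen (f ⁻¹' S) := by
  refine ⟨fun x y h hx => hS.upper (hf.monotone h) hx, fun d hn hd x hx h => ?_⟩
  obtain ⟨_, ⟨z, hz, rfl⟩, hzS⟩ := hS.inaccessible (f '' d) (hn.image f)
    (directedOn_image hf.monotone hd) (f x) (hf hn hd hx) h
  exact ⟨z, hz, hzS⟩

theorem singleton_true : IsScottOpen ({true} : Set Bool) := by
  refine ⟨fun a b h ha => ?_, fun d _ _ x hx h => ?_⟩
  · obtain rfl : a = true := ha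
    exact top_le_iff.1 h
  · obtain rfl : x = true := h
    by_contra! hne
    have : true ≤ false := hx.2 fun z hz => by
      cases z with
      | false => exact le_rfl
      | true => exact absurd rfl (hne true hz)
    exact absurd this (by decide)

/-- The image of a Scott-open set under an order embedding that is an upper map and does not hit
the least element. -/
theorem image_of_upper [OrderBot Y] {i : X → Y} (hi : ∀ {a b}, i a ≤ i b ↔ a ≤ b)
    (hup : ∀ a y, i a ≤ y → ∃ b, y = i b) (hlow : ∀ a y, y ≤ i a → y = ⊥ ∨ ∃ b, y = i b)
    (hbot : ∀ a, i a ≠ ⊥) {S : Set X} (hS : IsScottOpen S) : IsScottOpen (i '' S) := by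
  refine ⟨?_, fun d hn hd y hy h => ?_⟩
  · rintro _ y h ⟨a, ha, rfl⟩
    obtain ⟨b, rfl⟩ := hup a y h
    exact ⟨b, hS.upper (hi.1 h) ha, rfl⟩
  · obtain ⟨a, ha, rfl⟩ := h
    -- If `d` missed the range of `i`, its members, all below `i a`, would be `⊥`, and so would
    -- their supremum `i a`.
    obtain ⟨b, hb⟩ : ∃ b, i b ∈ d := by
      by_contra! hne
      refine hbot a (le_bot_iff.1 (hy.2 fun z hz => ?_))
      rcases hlow a z (hy.1 hz) with rfl | ⟨b, rfl⟩
      · exact le_rfl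
      · exact absurd hz (hne b)
    -- The part of `d` inside the range is cofinal: any `z ∈ d` has a common upper bound with `i b`
    -- in `d`, which lies in the range because the range is upward closed. So the preimage is
    -- directed with supremum `a`.
    obtain ⟨z, hz, hzS⟩ := hS.inaccessible (i ⁻¹' d) ⟨b, hb⟩
      (fun x hx y hy => by
        obtain ⟨w, hw, hxw, hyw⟩ := hd _ hx _ hy
        obtain ⟨c, rfl⟩ := hup x w hxw
        exact ⟨c, hw, hi.1 hxw, hi.1 hyw⟩) a
      ⟨fun z hz => hi.1 (hy.1 hz), fun c hc => hi.1 (hy.2 fun z hz => by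
        obtain ⟨w, hw, hzw, hbw⟩ := hd z hz _ hb
        obtain ⟨e, rfl⟩ := hup b w hbw
        exact hzw.trans (hi.2 (hc hw)))⟩ ha
    exact ⟨_, hz, z, hzS, rfl⟩

theorem image_inl {S : Set X} (hS : IsScottOpen S) :
    IsScottOpen ((fun x : X => ((Sum.inl x : X ⊕ Y) : WithBot (X ⊕ Y))) '' S) := by
  refine image_of_upper (WithBot.coe_le_coe.trans Sum.inl_le_inl_iff) ?_ ?_
    (fun _ => WithBot.coe_ne_bot) hS
  · rintro a (_ | b | b) h
    · exact absurd h (WithBot.not_coe_le_bot _)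
    · exact ⟨b, rfl⟩
    · exact absurd (WithBot.coe_le_coe.1 h) Sum.not_inl_le_inr
  · rintro a (_ | b | b) h
    · exact Or.inl rfl
    · exact Or.inr ⟨b, rfl⟩
    · exact absurd (WithBot.coe_le_coe.1 h) Sum.not_inr_le_inl

theorem image_inr {S : Set Y} (hS : IsScottOpen S) :
    IsScottOpen ((fun x : Y => ((Sum.inr x : X ⊕ Y) : WithBot (X ⊕ Y))) '' S) := by
  refine image_of_upper (WithBot.coe_le_coe.trans Sum.inr_le_inr_iff) ?_ ?_
    (fun _ => WithBot.coe_ne_bot) hS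
  · rintro a (_ | b | b) h
    · exact absurd h (WithBot.not_coe_le_bot _)
    · exact absurd (WithBot.coe_le_coe.1 h) Sum.not_inr_le_inl
    · exact ⟨b, rfl⟩
  · rintro a (_ | b | b) h
    · exact Or.inl rfl
    · exact absurd (WithBot.coe_le_coe.1 h) Sum.not_inl_le_inr
    · exact Or.inr ⟨b, rfl⟩

end IsScottOpen

-- Continuity of projections and evaluation, and openness of the modalities.

theorem scottContinuous_fst' {X Y : Type} [PartialOrder X] [PartialOrder Y] :
    ScottContinuous (Prod.fst : X × Y → X) := fun _ _ _ _ h => (isLUB_prod.1 h).1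

theorem scottContinuous_snd' {X Y : Type} [PartialOrder X] [PartialOrder Y] :
    ScottContinuous (Prod.snd : X × Y → Y) := fun _ _ _ _ h => (isLUB_prod.1 h).2

/-- Needed for the openness of implications: once the premise has a least point `a`, an implication
is an open condition on `f a`. -/
theorem scottContinuous_apply {σ τ : Ty} (a : den σ) :
    ScottContinuous (fun f : ScottMap (den σ) (den τ) => f.val a) := fun _ hn hd _ hf =>
  ScottMap.isLUB_apply (fun _ h h' => den_exists_isLUB τ h h') hn hd hf a

theorem Modality.sem_isScottOpen {σ τ : Ty} (m : Modality σ τ) {S : Set (den σ)}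
    (hS : IsScottOpen S) : IsScottOpen (m.sem S) := by
  cases m with
  | pi1 => exact hS.preimage scottContinuous_fst'
  | pi2 => exact hS.preimage scottContinuous_snd'
  | in1 => exact hS.image_inl
  | in2 => exact hS.image_inr
  | fold => exact hS.preimage (orderIso_scottContinuous (unfold _))

/-! ### Derivability between conjunctive formulae -/

/-- Without quantifiers no clause restricts the polarity. Hence the side condition `IsSequent` of
the rules is automatic between conjunctive formulae. -/
theorem IsConj.lang {τ : Ty} {φ : Form [] τ} (h : IsConj φ) : ∀ s, Lang s φ := by
  induction h with
  | top => exact fun _ => .top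
  | bot => exact fun _ => .bot
  | and _ _ h₁ h₂ => exact fun s => .and (h₁ s) (h₂ s)
  | star => exact fun _ => .star
  | modal _ h => exact fun s => .modal (h s)
  | imp _ _ h₁ h₂ => exact fun s => .imp (h₁ s.opp) (h₂ s)

theorem IsConj.isSequent {τ : Ty} {φ ψ : Form [] τ} (hψ : IsConj ψ) (hφ : IsConj φ) :
    IsSequent ψ φ := ⟨.neutral, hψ.lang _, hφ.lang _⟩

/-- A derivable and valid sequent between conjunctive formulae. -/
structure Seq (v : ℕ → ℕ) {τ : Ty} (ψ φ : Form [] τ) : Prop where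
  left : IsConj ψ
  right : IsConj φ
  ded : Ded ψ φ
  valid : ψ.sem Val.nil v ⊆ φ.sem Val.nil v

namespace Seq

variable {v : ℕ → ℕ} {σ τ : Ty} {ψ φ θ φ₁ φ₂ ψ₁ ψ₂ : Form [] τ}

theorem refl (h : IsConj φ) : Seq v φ φ := ⟨h, h, .refl (h.isSequent h), subset_rfl⟩

theorem trans (h : Seq v ψ θ) (h' : Seq v θ φ) : Seq v ψ φ :=
  ⟨h.left, h'.right, .cut (h.left.isSequent h'.right) h.ded h'.ded, h.valid.trans h'.valid⟩

theorem andR (h₁ : Seq v ψ φ₁) (h₂ : Seq v ψ φ₂) : Seq v ψ (and φ₁ φ₂) :=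
  ⟨h₁.left, h₁.right.and h₂.right, .andR (h₁.left.isSequent (h₁.right.and h₂.right)) h₁.ded h₂.ded,
    Set.subset_inter h₁.valid h₂.valid⟩

theorem andL₁ (h : Seq v ψ₁ φ) (h₂ : IsConj ψ₂) : Seq v (and ψ₁ ψ₂) φ :=
  ⟨h.left.and h₂, h.right, .andL₁ ((h.left.and h₂).isSequent h.right) h.ded,
    Set.inter_subset_left.trans h.valid⟩

theorem andL₂ (h : Seq v ψ₂ φ) (h₁ : IsConj ψ₁) : Seq v (and ψ₁ ψ₂) φ :=
  ⟨h₁.and h.left, h.right, .andL₂ ((h₁.and h.left).isSequent h.right) h.ded,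
    Set.inter_subset_right.trans h.valid⟩

theorem topR (h : IsConj ψ) : Seq v ψ top :=
  ⟨h, .top, .topR (h.isSequent .top), Set.subset_univ _⟩

theorem botL (h : IsConj φ) : Seq v bot φ :=
  ⟨.bot, h, .botL (IsConj.bot.isSequent h), Set.empty_subset _⟩

theorem and_mono (h₁ : Seq v ψ₁ φ₁) (h₂ : Seq v ψ₂ φ₂) : Seq v (and ψ₁ ψ₂) (and φ₁ φ₂) :=
  (h₁.andL₁ h₂.left).andR (h₂.andL₂ h₁.left)

theorem modalMono {ψ φ : Form [] σ} (m : Modality σ τ) (h : Seq v ψ φ) :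
    Seq v (modal m ψ) (modal m φ) :=
  ⟨h.left.modal, h.right.modal, .modalMono (h.left.modal.isSequent h.right.modal) h.ded, by
    change m.sem _ ⊆ m.sem _
    cases m with
    | pi1 => exact fun _ hx => h.valid hx
    | pi2 => exact fun _ hx => h.valid hx
    | in1 => exact Set.image_mono h.valid
    | in2 => exact Set.image_mono h.valid
    | fold => exact fun _ hx => h.valid hx⟩

theorem modalAnd {φ₁ φ₂ : Form [] σ} (m : Modality σ τ) (h₁ : IsConj φ₁) (h₂ : IsConj φ₂) :
    Seq v (and (modal m φ₁) (modal m φ₂)) (modal m (and φ₁ φ₂)) :=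
  ⟨h₁.modal.and h₂.modal, (h₁.and h₂).modal,
    .modalAnd ((h₁.modal.and h₂.modal).isSequent (h₁.and h₂).modal), by
    change m.sem _ ∩ m.sem _ ⊆ m.sem (_ ∩ _)
    cases m with
    | pi1 => exact fun _ hx => hx
    | pi2 => exact fun _ hx => hx
    | in1 =>
      rintro _ ⟨⟨a, ha, rfl⟩, ⟨b, hb, hab⟩⟩
      obtain rfl := Sum.inl_injective (WithBot.coe_injective hab)
      exact ⟨b, ⟨ha, hb⟩, rfl⟩
    | in2 =>
      rintro _ ⟨⟨a, ha, rfl⟩, ⟨b, hb, hab⟩⟩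
      obtain rfl := Sum.inr_injective (WithBot.coe_injective hab)
      exact ⟨b, ⟨ha, hb⟩, rfl⟩
    | fold => exact fun _ hx => hx⟩

theorem modalTop (m : Modality σ τ) (hm : ¬ m.IsInj) : Seq v top (modal m top) :=
  ⟨.top, .modal .top, .modalTop hm (IsConj.top.isSequent (.modal .top)), by
    change Set.univ ⊆ m.sem Set.univ
    cases m with
    | pi1 => exact fun _ _ => trivial
    | pi2 => exact fun _ _ => trivial
    | in1 => exact (hm trivial).elim
    | in2 => exact (hm trivial).elim
    | fold => exact fun _ _ => trivial⟩

theorem modalBot (m : Modality σ τ) : Seq v (modal m bot) bot :=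
  ⟨.modal .bot, .bot, .modalBot ((IsConj.modal .bot).isSequent .bot), by
    change m.sem ∅ ⊆ ∅
    cases m with
    | pi1 => exact fun _ hx => hx
    | pi2 => exact fun _ hx => hx
    | in1 => exact (Set.image_empty _).subset
    | in2 => exact (Set.image_empty _).subset
    | fold => exact fun _ hx => hx⟩

theorem injDisj {φ : Form [] σ} {ψ : Form [] τ} (hφ : IsConj φ) (hψ : IsConj ψ) :
    Seq v (and (modal .in1 φ) (modal .in2 ψ)) bot :=
  ⟨hφ.modal.and hψ.modal, .bot, .injDisj ((hφ.modal.and hψ.modal).isSequent .bot), by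
    rintro _ ⟨⟨a, _, rfl⟩, ⟨b, _, hab⟩⟩
    exact absurd (WithBot.coe_injective hab) Sum.inr_ne_inl⟩

theorem impMono {ψ ψ' : Form [] σ} {φ φ' : Form [] τ} (h : Seq v ψ' ψ) (h' : Seq v φ φ') :
    Seq v (imp ψ φ) (imp ψ' φ') :=
  ⟨h.right.imp h'.left, h.left.imp h'.right,
    .impMono ((h.right.imp h'.left).isSequent (h.left.imp h'.right)) h.ded h'.ded,
    fun _ hf x hx => h'.valid (hf x (h.valid hx))⟩

theorem impAnd {ψ : Form [] σ} (hψ : IsConj ψ) (h₁ : IsConj φ₁) (h₂ : IsConj φ₂) :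
    Seq v (and (imp ψ φ₁) (imp ψ φ₂)) (imp ψ (and φ₁ φ₂)) :=
  ⟨(hψ.imp h₁).and (hψ.imp h₂), hψ.imp (h₁.and h₂),
    .impAnd (((hψ.imp h₁).and (hψ.imp h₂)).isSequent (hψ.imp (h₁.and h₂))),
    fun _ hf x hx => ⟨hf.1 x hx, hf.2 x hx⟩⟩

theorem impTop {ψ : Form [] σ} (hψ : IsConj ψ) : Seq v top (imp ψ (top : Form [] τ)) :=
  ⟨.top, hψ.imp .top, .impTop (IsConj.top.isSequent (hψ.imp .top)), fun _ _ _ _ => trivial⟩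

theorem botImp (σ : Ty) (hφ : IsConj φ) : Seq v top (imp (bot : Form [] σ) φ) :=
  ⟨.top, IsConj.bot.imp hφ, .botImp (IsConj.top.isSequent (IsConj.bot.imp hφ)),
    fun _ _ _ hx => hx.elim⟩

/-- Consistency of `δ` gives the derivation and nonemptiness gives the inclusion. Both are assumed
because soundness of `Cons` is not established separately. -/
theorem impBot {δ : Form [] σ} (hδ : IsConj δ) (hC : Cons δ)
    (hne : (δ.sem Val.nil v).Nonempty) : Seq v (imp δ (bot : Form [] τ)) bot :=
  ⟨hδ.imp .bot, .bot, .impBot hC hδ ((hδ.imp .bot).isSequent .bot),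
    fun _ hf => hne.elim fun x hx => hf x hx⟩

end Seq

/-! ### Finite conjunctions -/

theorem IsConj.bigAnd {τ : Ty} {l : List (Form [] τ)} (h : ∀ φ ∈ l, IsConj φ) :
    IsConj (bigAnd l) := by
  induction l with
  | nil => exact .top
  | cons φ l ih =>
    exact .and (h φ List.mem_cons_self) (ih fun ψ hψ => h ψ (List.mem_cons_of_mem _ hψ))

theorem mem_sem_bigAnd {τ : Ty} {l : List (Form [] τ)} {v : ℕ → ℕ} {x : den τ} :
    x ∈ (bigAnd l).sem Val.nil v ↔ ∀ φ ∈ l, x ∈ φ.sem Val.nil v := by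
  induction l with
  | nil => exact iff_of_true trivial (by simp)
  | cons φ l ih => rw [List.forall_mem_cons, ← ih]; rfl

namespace Seq

variable {v : ℕ → ℕ} {σ τ : Ty}

theorem bigAndR {ψ : Form [] τ} {l : List (Form [] τ)} (hψ : IsConj ψ)
    (h : ∀ φ ∈ l, Seq v ψ φ) : Seq v ψ (bigAnd l) := by
  induction l with
  | nil => exact topR hψ
  | cons φ l ih =>
    exact (h φ List.mem_cons_self).andR (ih fun ψ hψ => h ψ (List.mem_cons_of_mem _ hψ))

theorem bigAndL {φ : Form [] τ} {l : List (Form [] τ)} (hl : ∀ φ ∈ l, IsConj φ) (h : φ ∈ l) :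
    Seq v (bigAnd l) φ := by
  induction l with
  | nil => simp at h
  | cons ψ l ih =>
    rw [List.forall_mem_cons] at hl
    rcases List.mem_cons.1 h with rfl | h
    · exact (refl hl.1).andL₁ (IsConj.bigAnd hl.2)
    · exact (ih hl.2 h).andL₂ hl.1

theorem impBigAnd {θ : Form [] (.arr σ τ)} {δ : Form [] σ} {l : List (Form [] τ)}
    (hθ : IsConj θ) (hδ : IsConj δ) (h : ∀ φ ∈ l, IsConj φ ∧ Seq v θ (imp δ φ)) :
    Seq v θ (imp δ (bigAnd l)) := by
  induction l with
  | nil => exact (topR hθ).trans (impTop hδ)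
  | cons φ l ih =>
    rw [List.forall_mem_cons] at h
    exact (h.1.2.andR (ih h.2)).trans
      (impAnd hδ h.1.1 (IsConj.bigAnd fun ψ hψ => (h.2 ψ hψ).1))

end Seq

-- Finite families of implications.

/-- The conjunction of the implications of a finite family. -/
def bigImp {σ τ : Ty} (I : List (Form [] σ × Form [] τ)) : Form [] (.arr σ τ) :=
  bigAnd (I.map fun p => imp p.1 p.2)

theorem IsConj.bigImp {σ τ : Ty} {I : List (Form [] σ × Form [] τ)}
    (h : ∀ p ∈ I, IsConj p.1 ∧ IsConj p.2) : IsConj (bigImp I) := by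
  refine IsConj.bigAnd fun φ hφ => ?_
  obtain ⟨p, hp, rfl⟩ := List.mem_map.1 hφ
  exact (h p hp).1.imp (h p hp).2

theorem mem_sem_bigImp {σ τ : Ty} {I : List (Form [] σ × Form [] τ)} {v : ℕ → ℕ}
    {f : ScottMap (den σ) (den τ)} :
    f ∈ (bigImp I).sem Val.nil v ↔
      ∀ p ∈ I, ∀ x ∈ p.1.sem Val.nil v, f.val x ∈ p.2.sem Val.nil v := by
  refine mem_sem_bigAnd.trans ?_
  rw [List.forall_mem_map]
  rfl

theorem mem_sem_bigAnd_map {α : Type} {τ : Ty} {I : List α} {g : α → Form [] τ} {v : ℕ → ℕ}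
    {x : den τ} : x ∈ (bigAnd (I.map g)).sem Val.nil v ↔ ∀ p ∈ I, x ∈ (g p).sem Val.nil v := by
  rw [mem_sem_bigAnd, List.forall_mem_map]

/-- The conjoined premises of `J` entail each premise in `J`, so by monotonicity each conclusion in
`J` may be put under this common premise, and the conclusions are then collected. Both refutations
of families and derivations of implications from families pass through this step. -/
theorem Seq.bigImp_subfamily {σ τ : Ty} {v : ℕ → ℕ} {I J : List (Form [] σ × Form [] τ)}
    (h : ∀ p ∈ I, IsConj p.1 ∧ IsConj p.2) (hJ : J ⊆ I) :
    Seq v (bigImp I) (imp (bigAnd (J.map Prod.fst)) (bigAnd (J.map Prod.snd))) := by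
  have hfst : ∀ φ ∈ J.map Prod.fst, IsConj φ := by
    rw [List.forall_mem_map]; exact fun p hp => (h p (hJ hp)).1
  refine Seq.impBigAnd (IsConj.bigImp h) (IsConj.bigAnd hfst) ?_
  rw [List.forall_mem_map]
  refine fun p hp => ⟨(h p (hJ hp)).2, Seq.trans (θ := imp p.1 p.2) ?_ ?_⟩
  · refine Seq.bigAndL ?_ (List.mem_map.2 ⟨p, hJ hp, rfl⟩)
    rw [List.forall_mem_map]
    exact fun q hq => (h q hq).1.imp (h q hq).2
  · exact .impMono (.bigAndL hfst (List.mem_map_of_mem hp)) (.refl (h p (hJ hp)).2)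

theorem Seq.bigImp_append {σ τ : Ty} {v : ℕ → ℕ} {I J : List (Form [] σ × Form [] τ)}
    (h : ∀ p ∈ I ++ J, IsConj p.1 ∧ IsConj p.2) :
    Seq v (and (bigImp I) (bigImp J)) (bigImp (I ++ J)) ∧
      Seq v (bigImp (I ++ J)) (and (bigImp I) (bigImp J)) := by
  have hI : ∀ p ∈ I, IsConj p.1 ∧ IsConj p.2 := fun p hp => h p (List.mem_append_left _ hp)
  have hJ : ∀ p ∈ J, IsConj p.1 ∧ IsConj p.2 := fun p hp => h p (List.mem_append_right _ hp)
  have conj : ∀ {K : List (Form [] σ × Form [] τ)}, (∀ p ∈ K, IsConj p.1 ∧ IsConj p.2) →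
      ∀ φ ∈ K.map (fun p => (imp p.1 p.2 : Form [] (.arr σ τ))), IsConj φ := fun hK => by
    rw [List.forall_mem_map]; exact fun p hp => (hK p hp).1.imp (hK p hp).2
  refine ⟨.bigAndR ((IsConj.bigImp hI).and (IsConj.bigImp hJ)) ?_,
    .andR (.bigAndR (.bigImp h) ?_) (.bigAndR (.bigImp h) ?_)⟩ <;> rw [List.forall_mem_map]
  · intro p hp
    rcases List.mem_append.1 hp with hp | hp
    · exact .andL₁ (.bigAndL (conj hI) (List.mem_map.2 ⟨p, hp, rfl⟩)) (.bigImp hJ)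
    · exact .andL₂ (.bigAndL (conj hJ) (List.mem_map.2 ⟨p, hp, rfl⟩)) (.bigImp hI)
  · exact fun p hp => .bigAndL (conj h) (List.mem_map.2 ⟨p, List.mem_append_left _ hp, rfl⟩)
  · exact fun p hp => .bigAndL (conj h) (List.mem_map.2 ⟨p, List.mem_append_right _ hp, rfl⟩)

/-! ### Conjunctive formulae of bounded depth -/

/-- The conjunctive formulae in which at most `n` modalities and implications are nested. -/
inductive IsConjD : ℕ → {τ : Ty} → Form [] τ → Prop
  | top {n : ℕ} {τ : Ty} : IsConjD n (top : Form [] τ)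
  | bot {n : ℕ} {τ : Ty} : IsConjD n (bot : Form [] τ)
  | and {n : ℕ} {τ : Ty} {φ ψ : Form [] τ} : IsConjD n φ → IsConjD n ψ → IsConjD n (and φ ψ)
  -- Counting `star` as depth one leaves only combinations of `⊤` and `⊥` at depth `0`.
  | star {n : ℕ} : IsConjD (n + 1) star
  | modal {n : ℕ} {σ τ : Ty} {m : Modality σ τ} {φ : Form [] σ} :
      IsConjD n φ → IsConjD (n + 1) (modal m φ)
  | imp {n : ℕ} {σ τ : Ty} {ψ : Form [] σ} {φ : Form [] τ} :
      IsConjD n ψ → IsConjD n φ → IsConjD (n + 1) (imp ψ φ)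

theorem IsConjD.isConj {n : ℕ} {τ : Ty} {φ : Form [] τ} (h : IsConjD n φ) : IsConj φ := by
  induction h with
  | top => exact .top
  | bot => exact .bot
  | and _ _ h₁ h₂ => exact .and h₁ h₂
  | star => exact .star
  | modal _ h => exact .modal h
  | imp _ _ h₁ h₂ => exact .imp h₁ h₂

theorem IsConjD.succ {n : ℕ} {τ : Ty} {φ : Form [] τ} (h : IsConjD n φ) : IsConjD (n + 1) φ := by
  induction h with
  | top => exact .top
  | bot => exact .bot
  | and _ _ h₁ h₂ => exact .and h₁ h₂
  | star => exact .star
  | modal _ h => exact .modal h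
  | imp _ _ h₁ h₂ => exact .imp h₁ h₂

theorem IsConjD.mono {n k : ℕ} {τ : Ty} {φ : Form [] τ} (h : IsConjD n φ) (hk : n ≤ k) :
    IsConjD k φ := by
  induction hk with
  | refl => exact h
  | step _ ih => exact ih.succ

theorem IsConj.exists_isConjD {τ : Ty} {φ : Form [] τ} (h : IsConj φ) : ∃ n, IsConjD n φ := by
  induction h with
  | top => exact ⟨0, .top⟩
  | bot => exact ⟨0, .bot⟩
  | and _ _ h₁ h₂ =>
    obtain ⟨n, hn⟩ := h₁
    obtain ⟨k, hk⟩ := h₂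
    exact ⟨max n k, .and (hn.mono (le_max_left _ _)) (hk.mono (le_max_right _ _))⟩
  | star => exact ⟨1, .star⟩
  | modal _ h =>
    obtain ⟨n, hn⟩ := h
    exact ⟨n + 1, .modal hn⟩
  | imp _ _ h₁ h₂ =>
    obtain ⟨n, hn⟩ := h₁
    obtain ⟨k, hk⟩ := h₂
    exact ⟨max n k + 1, .imp (hn.mono (le_max_left _ _)) (hk.mono (le_max_right _ _))⟩

/-- This is why the induction runs on depth and not on structure: the arrow case applies the
hypothesis to conjunctions of premises and of conclusions, which are not subformulae but have no
greater depth. -/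
theorem IsConjD.bigAnd {n : ℕ} {τ : Ty} {l : List (Form [] τ)} (h : ∀ φ ∈ l, IsConjD n φ) :
    IsConjD n (bigAnd l) := by
  induction l with
  | nil => exact .top
  | cons φ l ih =>
    exact .and (h φ List.mem_cons_self) (ih fun ψ hψ => h ψ (List.mem_cons_of_mem _ hψ))

theorem IsConjD.bigAnd_map {α : Type} {n : ℕ} {τ : Ty} {I : List α} {g : α → Form [] τ}
    (h : ∀ p ∈ I, IsConjD n (g p)) : IsConjD n (Form.bigAnd (I.map g)) :=
  .bigAnd (by rwa [List.forall_mem_map])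

-- The induction statement and its base case.

/-- Completeness, consistency and primality of the conjunctive formulae of depth at most `n`. -/
structure CompleteAt (v : ℕ → ℕ) (n : ℕ) : Prop where
  isScottOpen {τ : Ty} {φ : Form [] τ} : IsConjD n φ → IsScottOpen (φ.sem Val.nil v)
  cons {τ : Ty} {φ : Form [] τ} : IsConjD n φ → (φ.sem Val.nil v).Nonempty → Cons φ
  exists_isLeast {τ : Ty} {φ : Form [] τ} : IsConjD n φ → (φ.sem Val.nil v).Nonempty →
    ∃ a, IsLeast (φ.sem Val.nil v) a
  seq {τ : Ty} {ψ φ : Form [] τ} : IsConjD n ψ → IsConjD n φ →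
    ψ.sem Val.nil v ⊆ φ.sem Val.nil v → Seq v ψ φ

theorem CompleteAt.seq_bot {v : ℕ → ℕ} {n : ℕ} (H : CompleteAt v n) {τ : Ty} {φ : Form [] τ}
    (h : IsConjD n φ) (he : ¬ (φ.sem Val.nil v).Nonempty) : Seq v φ bot :=
  H.seq h .bot (Set.not_nonempty_iff_eq_empty.1 he).subset

theorem sem_nonempty_of_seq_top {v : ℕ → ℕ} {τ : Ty} {φ : Form [] τ} (h : Seq v top φ) :
    (φ.sem Val.nil v).Nonempty :=
  (den_exists_isBot τ).imp fun _ _ => h.valid trivial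

/-- A formula of depth `0` is equivalent to `⊤` or to `⊥`. -/
theorem IsConjD.seq_top_or_seq_bot {v : ℕ → ℕ} {n : ℕ} {τ : Ty} {φ : Form [] τ}
    (h : IsConjD n φ) (hn : n = 0) : Seq v Form.top φ ∨ Seq v φ Form.bot := by
  induction h with
  | top => exact Or.inl (.refl .top)
  | bot => exact Or.inr (.refl .bot)
  | and h₁ h₂ ih₁ ih₂ =>
    rcases ih₁ hn with h | h
    · rcases ih₂ hn with h' | h'
      · exact Or.inl (h.andR h')
      · exact Or.inr (h'.andL₂ h₁.isConj)
    · exact Or.inr (h.andL₁ h₂.isConj)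
  | star => cases hn
  | modal => cases hn
  | imp => cases hn

theorem completeAt_zero (v : ℕ → ℕ) : CompleteAt v 0 where
  isScottOpen h := by
    rcases h.seq_top_or_seq_bot (v := v) rfl with h | h
    · exact Set.univ_subset_iff.1 h.valid ▸ .univ
    · exact Set.subset_empty_iff.1 h.valid ▸ .empty
  cons h hne := by
    rcases h.seq_top_or_seq_bot (v := v) rfl with h | h
    · exact .ded .top h.ded h.right
    · exact absurd h.valid hne.not_subset_empty
  exists_isLeast {τ φ} h hne := by
    rcases h.seq_top_or_seq_bot (v := v) rfl with h | h
    · exact (den_exists_isBot τ).imp fun x hx => ⟨h.valid trivial, fun y _ => hx y⟩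
    · exact absurd h.valid hne.not_subset_empty
  seq {τ ψ φ} hψ hφ hsub := by
    rcases hψ.seq_top_or_seq_bot (v := v) rfl with h | h
    · rcases hφ.seq_top_or_seq_bot (v := v) rfl with h' | h'
      · exact (Seq.topR h.right).trans h'
      -- An inclusion of `⊤` in `⊥` is impossible, since every domain has a least element.
      · exact absurd h'.valid ((sem_nonempty_of_seq_top h).mono hsub).not_subset_empty
    · exact h.trans (.botL hφ.isConj)

/-! ### Step functions -/

section Step

variable {v : ℕ → ℕ} {n : ℕ} {σ τ : Ty} {I : List (Form [] σ × Form [] τ)}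

/-- The family `I` is semantically coherent. -/
def IsCoherent (v : ℕ → ℕ) (I : List (Form [] σ × Form [] τ)) : Prop :=
  ∀ J : List (Form [] σ × Form [] τ), J.Sublist I →
    ((bigAnd (J.map Prod.fst)).sem Val.nil v).Nonempty →
    ((bigAnd (J.map Prod.snd)).sem Val.nil v).Nonempty

open Classical in
/-- The members of the family `I` whose premise holds at `x`. -/
def active (v : ℕ → ℕ) (I : List (Form [] σ × Form [] τ)) (x : den σ) :
    List (Form [] σ × Form [] τ) := I.filter fun p => x ∈ p.1.sem Val.nil v

theorem active_sublist (x : den σ) : (active v I x).Sublist I := List.filter_sublist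

theorem mem_active {x : den σ} {p : Form [] σ × Form [] τ} :
    p ∈ active v I x ↔ p ∈ I ∧ x ∈ p.1.sem Val.nil v := by simp [active]

theorem mem_sem_active_fst (x : den σ) :
    x ∈ (bigAnd ((active v I x).map Prod.fst)).sem Val.nil v :=
  mem_sem_bigAnd_map.2 fun _ hp => (mem_active.1 hp).2

/-- Around `x`, some member of a directed set with supremum `x` activates what `x` does. -/
theorem exists_active_subset (hI : ∀ p ∈ I, IsScottOpen (p.1.sem Val.nil v)) {d : Set (den σ)}
    (hn : d.Nonempty) (hd : DirectedOn (· ≤ ·) d) {x : den σ} (hx : IsLUB d x) :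
    ∃ z ∈ d, active v I x ⊆ active v I z := by
  -- Finitely many premises are active at `x`, so their intersection is an open neighbourhood of
  -- `x`, which the directed set must meet.
  have hopen : IsScottOpen ((bigAnd ((active v I x).map Prod.fst)).sem Val.nil v) := by
    have : ∀ K : List (Form [] σ × Form [] τ), K ⊆ I →
        IsScottOpen ((bigAnd (K.map Prod.fst)).sem Val.nil v) := by
      intro K hK
      induction K with
      | nil => exact .univ
      | cons p K ih =>
        rw [List.cons_subset] at hK
        exact (hI p hK.1).inter (ih hK.2)
    exact this _ (active_sublist x).subset
  obtain ⟨z, hz, hzS⟩ := hopen.inaccessible d hn hd x hx (mem_sem_active_fst x)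
  exact ⟨z, hz, fun p hp =>
    mem_active.2 ⟨(mem_active.1 hp).1, mem_sem_bigAnd_map.1 hzS p hp⟩⟩

/-- The least function that realizes a coherent family of implications. -/
theorem CompleteAt.exists_isLeast_bigImp (H : CompleteAt v n)
    (hI : ∀ p ∈ I, IsConjD n p.1 ∧ IsConjD n p.2) (hc : IsCoherent v I) :
    ∃ f : ScottMap (den σ) (den τ), IsLeast ((bigImp I).sem Val.nil v) f ∧
      ∀ x, IsLeast ((bigAnd ((active v I x).map Prod.snd)).sem Val.nil v) (f.val x) := by
  -- The value at `x` is the least point satisfying all active conclusions. Coherence makes these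
  -- jointly satisfiable, as `x` itself satisfies the active premises.
  have hex : ∀ x, ∃ y, IsLeast ((bigAnd ((active v I x).map Prod.snd)).sem Val.nil v) y :=
    fun x => H.exists_isLeast
      (.bigAnd_map fun p hp => (hI p ((active_sublist x).subset hp)).2)
      (hc _ (active_sublist x) ⟨x, mem_sem_active_fst x⟩)
  choose u hu using hex
  have hle : ∀ {x y}, active v I x ⊆ active v I y → u x ≤ u y := fun {x y} h =>
    (hu x).2 (mem_sem_bigAnd_map.2 fun p hp => mem_sem_bigAnd_map.1 (hu y).1 p (h hp))
  have hopen : ∀ p ∈ I, IsScottOpen (p.1.sem Val.nil v) := fun p hp =>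
    H.isScottOpen (hI p hp).1
  have hmono : Monotone u := fun x y h => hle fun p hp => by
    rw [mem_active] at hp ⊢
    exact ⟨hp.1, (hopen p hp.1).upper h hp.2⟩
  have hcont : ScottContinuous u := by
    intro d hn hd x hx
    refine ⟨?_, fun y hy => ?_⟩
    · rintro _ ⟨z, hz, rfl⟩
      exact hmono (hx.1 hz)
    -- The value depends only on the active set and grows with it. Some `z ∈ d` activates everything
    -- active at `x`, so the value at `x` is already bounded by the value at `z`.
    · obtain ⟨z, hz, hsub⟩ := exists_active_subset hopen hn hd hx
      exact (hle hsub).trans (hy ⟨z, hz, rfl⟩)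
  refine ⟨⟨u, hcont⟩, ⟨mem_sem_bigImp.2 fun p hp x hx => ?_, fun g hg x => ?_⟩, hu⟩
  · exact mem_sem_bigAnd_map.1 (hu x).1 p (mem_active.2 ⟨hp, hx⟩)
  -- Any realizer `g` satisfies the active conclusions at `x`, so `g` lies above the least such
  -- value.
  · refine (hu x).2 (mem_sem_bigAnd_map.2 fun p hp => ?_)
    exact mem_sem_bigImp.1 hg p (mem_active.1 hp).1 x (mem_active.1 hp).2

/-- An incoherent family of implications is contradictory. -/
theorem CompleteAt.seq_bigImp_bot (H : CompleteAt v n)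
    (hI : ∀ p ∈ I, IsConjD n p.1 ∧ IsConjD n p.2) (hc : ¬ IsCoherent v I) :
    Seq v (bigImp I) bot := by
  simp only [IsCoherent, not_forall] at hc
  obtain ⟨J, hJ, h₁, h₂⟩ := hc
  have hfst : IsConjD n (bigAnd (J.map Prod.fst)) :=
    .bigAnd_map fun p hp => (hI p (hJ.subset hp)).1
  have hsnd : IsConjD n (bigAnd (J.map Prod.snd)) :=
    .bigAnd_map fun p hp => (hI p (hJ.subset hp)).2
  -- With `ψ` and `φ` the conjoined premises and conclusions of `J`, the family entails `ψ ⊩ φ`,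
  -- hence `ψ ⊩ ⊥` by completeness at depth `n`, hence `⊥` because `ψ` is provably consistent at
  -- depth `n`.
  exact (Seq.bigImp_subfamily (fun p hp => ⟨(hI p hp).1.isConj, (hI p hp).2.isConj⟩)
    hJ.subset).trans ((Seq.impMono (.refl hfst.isConj) (H.seq_bot hsnd h₂)).trans
      (.impBot hfst.isConj (H.cons hfst h₁) h₁))

/-- The depth-`n` hypothesis turns semantic coherence into the syntactic coherence demanded by the
rule `Cons.imp`: unsatisfiable premises become refutable, and satisfiable conclusions become
provably consistent. -/
theorem CompleteAt.cons_bigImp (H : CompleteAt v n)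
    (hI : ∀ p ∈ I, IsConjD n p.1 ∧ IsConjD n p.2)
    (hne : ∀ p ∈ I, (p.1.sem Val.nil v).Nonempty) (hc : IsCoherent v I) : Cons (bigImp I) := by
  refine .imp I (fun p hp => H.cons (hI p hp).1 (hne p hp)) (fun p hp => ?_) fun J hJ => ?_
  · refine H.cons (hI p hp).2 ?_
    -- Coherence of a one-element subfamily turns satisfiability of its premise into satisfiability
    -- of its conclusion.
    have := hc [p] (List.singleton_sublist.2 hp)
    obtain ⟨a, ha⟩ := hne p hp
    obtain ⟨b, hb⟩ := this ⟨a, ha, trivial⟩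
    exact ⟨b, hb.1⟩
  · by_cases h : ((bigAnd (J.map Prod.fst)).sem Val.nil v).Nonempty
    · exact .cons (H.cons (.bigAnd_map fun p hp => (hI p (hJ.subset hp)).2) (hc J hJ h))
    · exact .incons
        (H.seq_bot (.bigAnd_map fun p hp => (hI p (hJ.subset hp)).1) h).ded

/-- Completeness for an implication that follows from a coherent family of implications. -/
theorem CompleteAt.seq_bigImp_imp (H : CompleteAt v n)
    (hI : ∀ p ∈ I, IsConjD n p.1 ∧ IsConjD n p.2) (hc : IsCoherent v I)
    {α : Form [] σ} {β : Form [] τ} (hα : IsConjD n α) (hβ : IsConjD n β)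
    (hsub : (bigImp I).sem Val.nil v ⊆ (imp α β : Form [] (.arr σ τ)).sem Val.nil v) :
    Seq v (bigImp I) (imp α β) := by
  have hI' : ∀ p ∈ I, IsConj p.1 ∧ IsConj p.2 := fun p hp =>
    ⟨(hI p hp).1.isConj, (hI p hp).2.isConj⟩
  by_cases hne : (α.sem Val.nil v).Nonempty
  · obtain ⟨f, hf, hleast⟩ := H.exists_isLeast_bigImp hI hc
    obtain ⟨a, ha⟩ := H.exists_isLeast hα hne
    have hsubset := (active_sublist (v := v) (I := I) a).subset
    -- The implications active at the least point `a` of `α` suffice. Their premises are upward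
    -- closed and hold at `a`, hence on all of `α`. The least point of their conclusions is `f a`,
    -- which satisfies `β` because `f` realizes the family.
    refine (Seq.bigImp_subfamily hI' hsubset).trans
      (.impMono (H.seq hα (.bigAnd_map fun p hp => (hI p (hsubset hp)).1) fun x hx => ?_)
        (H.seq (.bigAnd_map fun p hp => (hI p (hsubset hp)).2) hβ fun y hy => ?_))
    · refine mem_sem_bigAnd_map.2 fun p hp => ?_
      exact (H.isScottOpen (hI p (hsubset hp)).1).upper (ha.2 hx) (mem_active.1 hp).2
    · exact (H.isScottOpen hβ).upper ((hleast a).2 hy) (hsub hf.1 a ha.1)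
  -- An unsatisfiable `α` is refutable, so `α ⊩ β` follows from `⊥ ⊩ β`, which is derivable from
  -- `⊤`.
  · exact (Seq.topR (.bigImp hI')).trans
      ((Seq.botImp σ hβ.isConj).trans (.impMono (H.seq_bot hα hne) (.refl hβ.isConj)))

end Step

/-! ### Normal forms -/

/-- Normal forms of the conjunctive formulae of depth at most `n + 1`. -/
inductive IsNormal (v : ℕ → ℕ) (n : ℕ) : {τ : Ty} → Form [] τ → Prop
  | bot {τ : Ty} : IsNormal v n (bot : Form [] τ)
  | unitTop : IsNormal v n (top : Form [] .unit)
  | star : IsNormal v n star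
  | pair {σ τ : Ty} {φ : Form [] σ} {ψ : Form [] τ} : IsConjD n φ → IsConjD n ψ →
      (φ.sem Val.nil v).Nonempty → (ψ.sem Val.nil v).Nonempty →
      IsNormal v n (and (modal .pi1 φ) (modal .pi2 ψ))
  | sumTop {σ τ : Ty} : IsNormal v n (top : Form [] (.sum σ τ))
  | in1 {σ τ : Ty} {φ : Form [] σ} : IsConjD n φ → (φ.sem Val.nil v).Nonempty →
      IsNormal v n (modal (.in1 : Modality σ (.sum σ τ)) φ)
  | in2 {σ τ : Ty} {φ : Form [] τ} : IsConjD n φ → (φ.sem Val.nil v).Nonempty →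
      IsNormal v n (modal (.in2 : Modality τ (.sum σ τ)) φ)
  | fold {τ : TyExpr 1} {φ : Form [] τ.unfolding} : IsConjD n φ → (φ.sem Val.nil v).Nonempty →
      IsNormal v n (modal .fold φ)
  | arr {σ τ : Ty} {I : List (Form [] σ × Form [] τ)} :
      (∀ p ∈ I, IsConjD n p.1 ∧ IsConjD n p.2) → (∀ p ∈ I, (p.1.sem Val.nil v).Nonempty) →
      IsCoherent v I → IsNormal v n (bigImp I)

/-- The formula has an equivalent normal form. -/
def HasNormal (v : ℕ → ℕ) (n : ℕ) {τ : Ty} (φ : Form [] τ) : Prop :=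
  ∃ φ', IsNormal v n φ' ∧ Seq v φ φ' ∧ Seq v φ' φ

-- Reduction of depth `n + 1` to normal forms.

section Normal

variable {v : ℕ → ℕ} {n : ℕ} {σ τ : Ty}

theorem HasNormal.of_seq {φ ψ : Form [] τ} (h : HasNormal v n φ) (h₁ : Seq v ψ φ)
    (h₂ : Seq v φ ψ) : HasNormal v n ψ := by
  obtain ⟨χ, hχ, h₃, h₄⟩ := h
  exact ⟨χ, hχ, h₁.trans h₃, h₄.trans h₂⟩

theorem HasNormal.of_seq_bot {φ : Form [] τ} (h : Seq v φ bot) : HasNormal v n φ :=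
  ⟨bot, .bot, h, .botL h.left⟩

theorem IsNormal.hasNormal {φ : Form [] τ} (h : IsNormal v n φ) (hφ : IsConj φ) :
    HasNormal v n φ := ⟨φ, h, .refl hφ, .refl hφ⟩

theorem CompleteAt.hasNormal_pair (H : CompleteAt v n) {φ : Form [] σ} {ψ : Form [] τ}
    (hφ : IsConjD n φ) (hψ : IsConjD n ψ) :
    HasNormal v n (and (modal .pi1 φ) (modal .pi2 ψ)) := by
  by_cases h₁ : (φ.sem Val.nil v).Nonempty
  · by_cases h₂ : (ψ.sem Val.nil v).Nonempty
    · exact (IsNormal.pair hφ hψ h₁ h₂).hasNormal (.and (.modal hφ.isConj) (.modal hψ.isConj))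
    · exact .of_seq_bot (.andL₂ ((Seq.modalMono _ (H.seq_bot hψ h₂)).trans (.modalBot _))
        (.modal hφ.isConj))
  · exact .of_seq_bot (.andL₁ ((Seq.modalMono _ (H.seq_bot hφ h₁)).trans (.modalBot _))
      (.modal hψ.isConj))

theorem CompleteAt.hasNormal_modal (H : CompleteAt v n) (m : Modality σ τ) {φ : Form [] σ}
    (hφ : IsConjD n φ) : HasNormal v n (modal m φ) := by
  by_cases h : (φ.sem Val.nil v).Nonempty
  · have hc : ∀ {τ : Ty} {m : Modality σ τ}, IsConj (modal m φ) := .modal hφ.isConj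
    cases m with
    | pi1 =>
      -- The missing component is supplied by `⊤`, using the fact that projections preserve `⊤`.
      refine (H.hasNormal_pair hφ .top).of_seq
        ((Seq.refl hc).andR ((Seq.topR hc).trans (.modalTop _ id))) ?_
      exact (Seq.refl hc).andL₁ (.modal .top)
    | pi2 =>
      refine (H.hasNormal_pair .top hφ).of_seq
        (((Seq.topR hc).trans (.modalTop _ id)).andR (Seq.refl hc)) ?_
      exact (Seq.refl hc).andL₂ (.modal .top)
    | in1 => exact (IsNormal.in1 hφ h).hasNormal hc
    | in2 => exact (IsNormal.in2 hφ h).hasNormal hc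
    | fold => exact (IsNormal.fold hφ h).hasNormal hc
  · exact .of_seq_bot ((Seq.modalMono _ (H.seq_bot hφ h)).trans (.modalBot _))

theorem CompleteAt.hasNormal_bigImp (H : CompleteAt v n) {I : List (Form [] σ × Form [] τ)}
    (hI : ∀ p ∈ I, IsConjD n p.1 ∧ IsConjD n p.2)
    (hne : ∀ p ∈ I, (p.1.sem Val.nil v).Nonempty) : HasNormal v n (bigImp I) := by
  by_cases hc : IsCoherent v I
  · exact (IsNormal.arr hI hne hc).hasNormal
      (.bigImp fun p hp => ⟨(hI p hp).1.isConj, (hI p hp).2.isConj⟩)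
  · exact .of_seq_bot (H.seq_bigImp_bot hI hc)

/-- Only unit and sum types keep `⊤` as a separate normal form. Elsewhere it is absorbed by the
pair, fold and empty-family shapes, which reduces the cases to be compared later. -/
theorem CompleteAt.hasNormal_top (H : CompleteAt v n) : ∀ τ : Ty,
    HasNormal v n (Form.top : Form [] τ)
  | .var i => i.elim0
  | .unit => IsNormal.unitTop.hasNormal .top
  | .prod _ _ => (H.hasNormal_pair .top .top).of_seq
      ((Seq.modalTop _ id).andR (.modalTop _ id)) (.topR (.and (.modal .top) (.modal .top)))
  | .arr _ _ => H.hasNormal_bigImp (I := []) (by simp) (by simp)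
  | .sum _ _ => IsNormal.sumTop.hasNormal .top
  | .recty _ => (H.hasNormal_modal .fold .top).of_seq (.modalTop _ id) (.topR (.modal .top))

/-- An implication with an unsatisfiable premise is provably `⊤` and is discarded. Families
therefore keep only satisfiable premises, which the consistency rule for implications needs. -/
theorem CompleteAt.hasNormal_imp (H : CompleteAt v n) {ψ : Form [] σ} {φ : Form [] τ}
    (hψ : IsConjD n ψ) (hφ : IsConjD n φ) :
    HasNormal v n (Form.imp ψ φ : Form [] (.arr σ τ)) := by
  have hc : IsConj (Form.imp ψ φ : Form [] (.arr σ τ)) := .imp hψ.isConj hφ.isConj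
  by_cases h : (ψ.sem Val.nil v).Nonempty
  · refine (H.hasNormal_bigImp (I := [(ψ, φ)]) ?_ ?_).of_seq
      ((Seq.refl hc).andR (.topR hc)) ((Seq.refl hc).andL₁ .top)
    · simpa using ⟨hψ, hφ⟩
    · simpa using h
  · exact (H.hasNormal_top _).of_seq (.topR hc) ((Seq.botImp σ hφ.isConj).trans
      (.impMono (H.seq_bot hψ h) (.refl hφ.isConj)))

theorem CompleteAt.hasNormal_and_modal (H : CompleteAt v n) (m : Modality σ τ)
    {φ ψ : Form [] σ} (hφ : IsConjD n φ) (hψ : IsConjD n ψ) :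
    HasNormal v n (and (modal m φ) (modal m ψ)) :=
  (H.hasNormal_modal m (.and hφ hψ)).of_seq (.modalAnd m hφ.isConj hψ.isConj)
    (.andR (.modalMono m (.andL₁ (.refl hφ.isConj) hψ.isConj))
      (.modalMono m (.andL₂ (.refl hψ.isConj) hφ.isConj)))

theorem Seq.and_comm {φ ψ : Form [] τ} (hφ : IsConj φ) (hψ : IsConj ψ) :
    Seq v (and φ ψ) (and ψ φ) :=
  (Seq.andL₂ (.refl hψ) hφ).andR (.andL₁ (.refl hφ) hψ)

/-- Equal modalities merge componentwise, opposite injections clash, and families of implications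
are concatenated. Merging may destroy satisfiability or coherence, in which case the result
collapses to `⊥`. -/
theorem CompleteAt.hasNormal_and (H : CompleteAt v n) {φ ψ : Form [] τ} (hφ : IsNormal v n φ)
    (hψ : IsNormal v n ψ) (cφ : IsConj φ) (cψ : IsConj ψ) : HasNormal v n (Form.and φ ψ) := by
  have botLeft : ∀ {ψ : Form [] τ}, IsConj ψ → HasNormal v n (Form.and bot ψ) := fun h =>
    .of_seq_bot (.andL₁ (.refl .bot) h)
  have topLeft : ∀ {ψ : Form [] τ}, IsConj ψ → IsNormal v n ψ →
      HasNormal v n (Form.and top ψ) := fun c h =>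
    (h.hasNormal c).of_seq (.andL₂ (.refl c) .top) (.andR (.topR c) (.refl c))
  have comm : HasNormal v n (Form.and ψ φ) → HasNormal v n (Form.and φ ψ) := fun h =>
    h.of_seq (.and_comm cφ cψ) (.and_comm cψ cφ)
  cases hφ with
  | bot => exact botLeft cψ
  | unitTop => exact topLeft cψ hψ
  | star =>
    cases hψ with
    | bot => exact comm (botLeft cφ)
    | unitTop => exact comm (topLeft cφ .star)
    | star =>
      exact (IsNormal.star.hasNormal .star).of_seq (.andL₁ (.refl .star) .star)
        (.andR (.refl .star) (.refl .star))
  | pair h₁ h₂ ne₁ ne₂ =>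
    cases hψ with
    | bot => exact comm (botLeft cφ)
    | pair h₃ h₄ _ _ =>
      have c₁ := h₁.isConj
      have c₂ := h₂.isConj
      have c₃ := h₃.isConj
      have c₄ := h₄.isConj
      refine (H.hasNormal_pair (.and h₁ h₃) (.and h₂ h₄)).of_seq (.andR ?_ ?_) (.andR ?_ ?_)
      · exact (Seq.and_mono (.andL₁ (.refl c₁.modal) c₂.modal)
          (.andL₁ (.refl c₃.modal) c₄.modal)).trans (.modalAnd _ c₁ c₃)
      · exact (Seq.and_mono (.andL₂ (.refl c₂.modal) c₁.modal)
          (.andL₂ (.refl c₄.modal) c₃.modal)).trans (.modalAnd _ c₂ c₄)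
      · exact .and_mono (.modalMono _ (.andL₁ (.refl c₁) c₃)) (.modalMono _ (.andL₁ (.refl c₂) c₄))
      · exact .and_mono (.modalMono _ (.andL₂ (.refl c₃) c₁)) (.modalMono _ (.andL₂ (.refl c₄) c₂))
  | sumTop => exact topLeft cψ hψ
  | in1 h ne =>
    cases hψ with
    | bot => exact comm (botLeft cφ)
    | sumTop => exact comm (topLeft cφ (.in1 h ne))
    | in1 h' _ => exact H.hasNormal_and_modal _ h h'
    | in2 h' _ => exact .of_seq_bot (.injDisj h.isConj h'.isConj)
  | in2 h ne =>
    cases hψ with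
    | bot => exact comm (botLeft cφ)
    | sumTop => exact comm (topLeft cφ (.in2 h ne))
    | in1 h' _ => exact comm (.of_seq_bot (.injDisj h'.isConj h.isConj))
    | in2 h' _ => exact H.hasNormal_and_modal _ h h'
  | fold h ne =>
    cases hψ with
    | bot => exact comm (botLeft cφ)
    | fold h' _ => exact H.hasNormal_and_modal _ h h'
  | arr hI ne _ =>
    cases hψ with
    | bot => exact comm (botLeft cφ)
    | arr hI' ne' _ =>
      have h := List.forall_mem_append.2 ⟨hI, hI'⟩
      have := Seq.bigImp_append (v := v) fun p hp => ⟨(h p hp).1.isConj, (h p hp).2.isConj⟩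
      exact (H.hasNormal_bigImp h (List.forall_mem_append.2 ⟨ne, ne'⟩)).of_seq this.1 this.2

/-- Conjunction does not lower the depth, so an inner structural induction at the fixed depth `n +
1` is needed. The equation `hk` keeps that index general. -/
theorem CompleteAt.hasNormal (H : CompleteAt v n) {k : ℕ} {φ : Form [] τ} (h : IsConjD k φ)
    (hk : k = n + 1) : HasNormal v n φ := by
  induction h with
  | top => exact H.hasNormal_top _
  | bot => exact .of_seq_bot (.refl .bot)
  | and _ _ h₁ h₂ =>
    obtain ⟨φ', hφ', h₁, h₁'⟩ := h₁ hk
    obtain ⟨ψ', hψ', h₂, h₂'⟩ := h₂ hk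
    exact (H.hasNormal_and hφ' hψ' h₁.right h₂.right).of_seq (.and_mono h₁ h₂) (.and_mono h₁' h₂')
  | star => exact IsNormal.star.hasNormal .star
  | modal h => obtain rfl := Nat.succ.inj hk; exact H.hasNormal_modal _ h
  | imp h h' => obtain rfl := Nat.succ.inj hk; exact H.hasNormal_imp h h'

/-! ### Completeness for normal forms -/

/-- The least element of a sum type. -/
def sumBot (σ τ : Ty) : den (.sum σ τ) := (⊥ : WithBot (den σ ⊕ den τ))

theorem symm_mem_sem_fold {τ : TyExpr 1} {φ : Form [] τ.unfolding} {x : den τ.unfolding} :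
    (unfold τ).symm x ∈ (modal .fold φ).sem Val.nil v ↔ x ∈ φ.sem Val.nil v := by
  change unfold τ ((unfold τ).symm x) ∈ φ.sem Val.nil v ↔ _
  rw [OrderIso.apply_symm_apply]

/-- Each shape other than `⊥` matches a consistency rule, and its least element is assembled from
those of the parts: a pair, an injection, an inverse image under `unfold`, or a least step function.
-/
theorem CompleteAt.isLeast_and_cons (H : CompleteAt v n) {φ : Form [] τ}
    (h : IsNormal v n φ) : φ = Form.bot ∨ Cons φ ∧ ∃ a, IsLeast (φ.sem Val.nil v) a := by
  cases h with
  | bot => exact Or.inl rfl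
  | unitTop => exact Or.inr ⟨.top, (false : Bool), trivial, fun a _ => Bool.false_le a⟩
  | star => exact Or.inr ⟨.star, (true : Bool), rfl, fun a ha => le_of_eq (Eq.symm ha)⟩
  | pair h₁ h₂ ne₁ ne₂ =>
    obtain ⟨a, ha⟩ := H.exists_isLeast h₁ ne₁
    obtain ⟨b, hb⟩ := H.exists_isLeast h₂ ne₂
    exact Or.inr ⟨.pair (H.cons h₁ ne₁) (H.cons h₂ ne₂), (a, b), ⟨ha.1, hb.1⟩,
      fun p hp => ⟨ha.2 hp.1, hb.2 hp.2⟩⟩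
  | sumTop => exact Or.inr ⟨.top, (den_exists_isBot _).imp fun x hx => ⟨trivial, fun y _ => hx y⟩⟩
  | in1 h ne =>
    obtain ⟨a, ha⟩ := H.exists_isLeast h ne
    refine Or.inr ⟨.in1 (H.cons h ne), _, ⟨a, ha.1, rfl⟩, ?_⟩
    rintro _ ⟨b, hb, rfl⟩
    exact WithBot.coe_le_coe.2 (Sum.inl_le_inl_iff.2 (ha.2 hb))
  | in2 h ne =>
    obtain ⟨a, ha⟩ := H.exists_isLeast h ne
    refine Or.inr ⟨.in2 (H.cons h ne), _, ⟨a, ha.1, rfl⟩, ?_⟩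
    rintro _ ⟨b, hb, rfl⟩
    exact WithBot.coe_le_coe.2 (Sum.inr_le_inr_iff.2 (ha.2 hb))
  | @fold τ φ h ne =>
    obtain ⟨a, ha⟩ := H.exists_isLeast h ne
    refine Or.inr ⟨.fold (H.cons h ne), (unfold τ).symm a, ?_, fun y hy => ?_⟩
    · exact symm_mem_sem_fold.2 ha.1
    · exact (unfold τ).symm_apply_le.2 (ha.2 hy)
  | arr hI ne hc =>
    obtain ⟨f, hf, _⟩ := H.exists_isLeast_bigImp hI hc
    exact Or.inr ⟨H.cons_bigImp hI ne hc, f, hf⟩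

/-- Evaluating the inclusion at suitable points gives an inclusion of components at depth `n`, or a
contradiction when the shapes disagree. -/
theorem CompleteAt.seq_modal (H : CompleteAt v n) (m : Modality σ τ) {ψ : Form [] τ}
    {φ : Form [] σ} (hψ : IsNormal v n ψ) (hφ : IsConjD n φ)
    (hsub : ψ.sem Val.nil v ⊆ (modal m φ).sem Val.nil v) : Seq v ψ (modal m φ) := by
  have cφ := hφ.isConj
  cases m with
  | pi1 =>
    cases hψ with
    | bot => exact .botL cφ.modal
    | pair h₁ h₂ _ ne =>
      refine .andL₁ (.modalMono _ (H.seq h₁ hφ fun x hx => ?_)) h₂.isConj.modal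
      -- A witness of the other component completes `x` to a point of the pair; this is what
      -- satisfiability of both parts is for.
      obtain ⟨y, hy⟩ := ne
      exact hsub (a := (x, y)) ⟨hx, hy⟩
  | pi2 =>
    cases hψ with
    | bot => exact .botL cφ.modal
    | pair h₁ h₂ ne _ =>
      refine .andL₂ (.modalMono _ (H.seq h₂ hφ fun y hy => ?_)) h₁.isConj.modal
      obtain ⟨x, hx⟩ := ne
      exact hsub (a := (x, y)) ⟨hx, hy⟩
  | in1 =>
    cases hψ with
    | bot => exact .botL cφ.modal
    | sumTop =>
      -- The least element of the sum satisfies `⊤` but lies outside both injections.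
      obtain ⟨x, _, hx⟩ := hsub (a := sumBot _ _) trivial
      exact absurd hx WithBot.coe_ne_bot
    | in1 h ne =>
      refine .modalMono _ (H.seq h hφ fun x hx => ?_)
      obtain ⟨y, hy, hyx⟩ := hsub ⟨x, hx, rfl⟩
      obtain rfl := Sum.inl_injective (WithBot.coe_injective hyx)
      exact hy
    | in2 h ne =>
      obtain ⟨x, hx⟩ := ne
      obtain ⟨y, hy, hyx⟩ := hsub ⟨x, hx, rfl⟩
      exact absurd (WithBot.coe_injective hyx) Sum.inl_ne_inr
  | in2 =>
    cases hψ with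
    | bot => exact .botL cφ.modal
    | sumTop =>
      obtain ⟨x, _, hx⟩ := hsub (a := sumBot _ _) trivial
      exact absurd hx WithBot.coe_ne_bot
    | in1 h ne =>
      obtain ⟨x, hx⟩ := ne
      obtain ⟨y, hy, hyx⟩ := hsub ⟨x, hx, rfl⟩
      exact absurd (WithBot.coe_injective hyx) Sum.inr_ne_inl
    | in2 h ne =>
      refine .modalMono _ (H.seq h hφ fun x hx => ?_)
      obtain ⟨y, hy, hyx⟩ := hsub ⟨x, hx, rfl⟩
      obtain rfl := Sum.inr_injective (WithBot.coe_injective hyx)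
      exact hy
  | fold =>
    cases hψ with
    | bot => exact .botL cφ.modal
    | fold h ne =>
      refine .modalMono _ (H.seq h hφ fun x hx => ?_)
      exact symm_mem_sem_fold.1 (hsub (symm_mem_sem_fold.2 hx))

/-- Only the left formula has to be normal. The right one is decomposed by induction, since a
conjunction on the right splits into two goals. -/
theorem CompleteAt.seq_of_isNormal (H : CompleteAt v n) {k : ℕ} {ψ φ : Form [] τ}
    (h : IsConjD k φ) (hk : k = n + 1) (hψ : IsNormal v n ψ) (cψ : IsConj ψ)
    (hsub : ψ.sem Val.nil v ⊆ φ.sem Val.nil v) : Seq v ψ φ := by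
  induction h with
  | top => exact .topR cψ
  | bot =>
    rcases H.isLeast_and_cons hψ with rfl | ⟨_, a, ha⟩
    · exact .refl .bot
    · exact (hsub ha.1).elim
  | and _ _ h₁ h₂ =>
    exact .andR (h₁ hk hψ cψ (hsub.trans Set.inter_subset_left))
      (h₂ hk hψ cψ (hsub.trans Set.inter_subset_right))
  | star =>
    cases hψ with
    | bot => exact .botL .star
    | unitTop => exact absurd (hsub (a := (false : Bool)) trivial) Bool.false_ne_true
    | star => exact .refl .star
  | modal h => obtain rfl := Nat.succ.inj hk; exact H.seq_modal _ hψ h hsub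
  | imp h h' =>
    obtain rfl := Nat.succ.inj hk
    cases hψ with
    | bot => exact .botL (.imp h.isConj h'.isConj)
    | arr hI _ hc => exact H.seq_bigImp_imp hI hc h h' hsub

-- Openness at depth `n + 1` and the inductive step.

theorem CompleteAt.isScottOpen_succ (H : CompleteAt v n) {k : ℕ} {φ : Form [] τ}
    (h : IsConjD k φ) (hk : k = n + 1) : IsScottOpen (φ.sem Val.nil v) := by
  induction h with
  | top => exact .univ
  | bot => exact .empty
  | and _ _ h₁ h₂ => exact (h₁ hk).inter (h₂ hk)
  | star => exact .singleton_true
  | @modal _ _ _ m _ h =>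
    obtain rfl := Nat.succ.inj hk
    exact m.sem_isScottOpen (H.isScottOpen h)
  | @imp _ σ τ ψ φ h h' =>
    obtain rfl := Nat.succ.inj hk
    change IsScottOpen {f : ScottMap (den σ) (den τ) |
      ∀ x ∈ ψ.sem Val.nil v, f.val x ∈ φ.sem Val.nil v}
    by_cases hne : (ψ.sem Val.nil v).Nonempty
    · obtain ⟨a, ha⟩ := H.exists_isLeast h hne
      -- With `a` the least point of the premise and the conclusion upward closed, realizing the
      -- implication means exactly that `f a` satisfies the conclusion. The denotation is thus the
      -- preimage of an open set under evaluation at `a`.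
      convert (H.isScottOpen h').preimage (scottContinuous_apply a) using 1
      ext f
      exact ⟨fun hf => hf a ha.1, fun hf x hx =>
        (H.isScottOpen h').upper (f.property.monotone (ha.2 hx)) hf⟩
    · convert IsScottOpen.univ using 1
      ext f
      exact iff_of_true (fun x hx => (hne ⟨x, hx⟩).elim) trivial

theorem CompleteAt.succ (H : CompleteAt v n) : CompleteAt v (n + 1) where
  isScottOpen h := H.isScottOpen_succ h rfl
  cons h hne := by
    obtain ⟨φ', hφ', h₁, h₂⟩ := H.hasNormal h rfl
    rcases H.isLeast_and_cons hφ' with rfl | ⟨hC, _⟩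
    · exact absurd h₁.valid hne.not_subset_empty
    · exact .ded hC h₂.ded h.isConj
  exists_isLeast h hne := by
    obtain ⟨φ', hφ', h₁, h₂⟩ := H.hasNormal h rfl
    rcases H.isLeast_and_cons hφ' with rfl | ⟨_, a, ha⟩
    · exact absurd h₁.valid hne.not_subset_empty
    · exact ⟨a, h₂.valid ha.1, fun b hb => ha.2 (h₁.valid hb)⟩
  seq hψ hφ hsub := by
    obtain ⟨ψ', hψ', h₁, h₂⟩ := H.hasNormal hψ rfl
    exact h₁.trans (H.seq_of_isNormal hφ rfl hψ' h₁.right (h₂.valid.trans hsub))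

end Normal

theorem completeAt (v : ℕ → ℕ) : ∀ n, CompleteAt v n
  | 0 => completeAt_zero v
  | n + 1 => (completeAt v n).succ

end PosLog
end

theorem mainTheorem5 (τ : PosLog.Ty) (φ ψ : PosLog.Form [] τ)
    (hφ : PosLog.IsConj φ) (hψ : PosLog.IsConj ψ) (v : ℕ → ℕ) :
    ((φ.sem PosLog.Val.nil v).Nonempty → PosLog.Cons φ) ∧
      (ψ.sem PosLog.Val.nil v ⊆ φ.sem PosLog.Val.nil v → PosLog.Ded ψ φ) := by
  obtain ⟨n, hn⟩ := hφ.exists_isConjD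
  obtain ⟨k, hk⟩ := hψ.exists_isConjD
  exact ⟨(PosLog.completeAt v n).cons hn, fun h =>
    -- The two formulae may differ in depth; both are compared at the larger one.
    ((PosLog.completeAt v (max k n)).seq (hk.mono (le_max_left _ _))
      (hn.mono (le_max_right _ _)) h).ded⟩
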